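/- Let $\psi(z)=\sum_{j=1}^{l}b_je^{2\pi i\beta_jz}$ and $\varphi(z)=\sum_{j=1}^{m}d_je^{2\pi i\alpha_jz}$ be exponential polynomials with real frequencies $\beta_j,\alpha_j$ and complex coefficients $b_j,d_j$, and write $\Lambda_\psi,\Lambda_\varphi\subset\mathbb C$ for their sets of complex zeros. Assume that all zeros of $\varphi$ are real and simple, that $\Lambda_\varphi$ is uniformly discrete (distances between distinct points have a positive lower bound), and that $\Lambda_\varphi\not\subset\Lambda_\psi$. Put $$c_\lambda=\frac{\psi(\lambda)}{\varphi'(\lambda)}\quad(\lambda\in\Lambda_\varphi),\qquad \mu=\sum_{\lambda\in\Lambda_\varphi}c_\lambda\delta_\lambda .$$ Then $(c_\lambda)$ is bounded, $\mu$ is a tempered distribution, and $\mu$ is a crystalline measure: $\mu$ and its distributional Fourier transform $\hat\mu$ are both purely atomic measures supported by locally finite sets. More precisely, there are sets $S_+,S_-\subset\mathbb R$ and complex coefficients $(p_s)$, $(q_s)$, vanishing off $S_+$ and $S_-$ respectively, and some $R>0$, such that, with absolutely convergent sums, $$\frac{\psi(z)}{\varphi(z)}=\sum_{s\in S_+}p_se^{2\pi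 isz}\ (\operatorname{Im}z\ge R),\qquad \frac{\psi(z)}{\varphi(z)}=\sum_{s\in S_-}q_se^{-2\pi isz}\ (\operatorname{Im}z\le -R).$$ With $S=S_-\cup(-S_+)$ and $a_s=\dfrac{q_s-p_{-s}}{2\pi i}$ for $s\in S$, each of the sets $S_+$, $S_-$ and $S$ is locally finite and has at most $Cr^k$ points in $(-r,r)$ for all $r>1$ (for some constants $C,k$), the sequence $(a_s)_{s\in S}$ is bounded, and for every Schwartz function $f$ $$\sum_{\lambda\in\Lambda_\varphi}c_\lambda f(\lambda)=\sum_{s\in S}a_s\hat f(s),\qquad \hat f(t)=\int_{\mathbb R}f(x)e^{-2\pi itx}\,dx,$$ both sums converging absolutely. Equivalently, if $\hat\mu$ is defined by $\langle\hat\mu,f\rangle=\langle\mu,\hat f\rangle$, then $$\hat\mu=\sum_{s\in S}a_s\delta_{-s}.$$ -/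

import Mathlib

open scoped SchwartzMap FourierTransform

noncomputable section

/-- The class `Exp` of exponential polynomials with imaginary frequencies:
`ψ(z) = ∑_{j=1}^{l} b_j e^{2π i α_j z}` with `α_j` real and `b_j` complex. -/
def IsExpPoly (ψ : ℂ → ℂ) : Prop :=
  ∃ (l : ℕ) (α : Fin l → ℝ) (b : Fin l → ℂ),
    ∀ z : ℂ, ψ z = ∑ j, b j * Complex.exp (2 * Real.pi * Complex.I * α j * z)

/-- The set `Λ_ψ` of complex zeros of `ψ`. -/
def zeroSet (ψ : ℂ → ℂ) : Set ℂ := {z | ψ z = 0}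

/-- The set of real zeros of `ψ`, as a set of real numbers. -/
def realZeroSet (ψ : ℂ → ℂ) : Set ℝ := {x | ψ (x : ℂ) = 0}

/-- Uniformly discrete sets: the distances between distinct points have a positive lower bound. -/
def IsUniformlyDiscrete {X : Type*} [PseudoMetricSpace X] (Λ : Set X) : Prop :=
  ∃ δ : ℝ, 0 < δ ∧ ∀ x ∈ Λ, ∀ y ∈ Λ, x ≠ y → δ ≤ dist x y

/-- The class `Exp_s`: exponential polynomials with simple zeros and uniformly discrete zero set. -/
structure IsExpPolyS (φ : ℂ → ℂ) : Prop where
  isExpPoly : IsExpPoly φ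
  simple : ∀ z ∈ zeroSet φ, deriv φ z ≠ 0
  uniformlyDiscrete : IsUniformlyDiscrete (zeroSet φ)

/-- The class `Exp_r`: the members of `Exp_s` all of whose complex zeros are real. -/
structure IsExpPolyR (φ : ℂ → ℂ) : Prop extends IsExpPolyS φ where
  real : ∀ z ∈ zeroSet φ, z.im = 0

/-- Locally finite sets of reals: finitely many points in every bounded interval. -/
def IsLocallyFiniteSet (S : Set ℝ) : Prop :=
  ∀ r : ℝ, (S ∩ Set.Ioo (-r) r).Finite

/-- `S` is locally finite and `#(S ∩ (-r, r)) ≤ C r ^ m` for all `r > 1`, for some `C` and `m`. -/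
def HasPolynomialCount (S : Set ℝ) : Prop :=
  IsLocallyFiniteSet S ∧
    ∃ (C : ℝ) (m : ℕ), ∀ r : ℝ, 1 < r → ((S ∩ Set.Ioo (-r) r).ncard : ℝ) ≤ C * r ^ m

/-- The tempered distribution `T` is the purely atomic measure `∑_{x ∈ Λ} c x • δ_x`, supported by
the locally finite set `Λ`: it agrees with this measure on all test functions of compact support
(for which the sum has only finitely many nonzero terms). -/
def IsAtomicMeasure (T : 𝓢'(ℝ, ℂ)) (Λ : Set ℝ) (c : ℝ → ℂ) : Prop :=
  IsLocallyFiniteSet Λ ∧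
    ∀ f : 𝓢(ℝ, ℂ), HasCompactSupport f → HasSum (fun x : Λ => c x * f x) (T f)

/-- Crystalline measures: purely atomic measures supported by a locally finite set whose
distributional Fourier transform is a purely atomic measure supported by a locally finite set. -/
def IsCrystallineMeasure (μ : 𝓢'(ℝ, ℂ)) : Prop :=
  (∃ (Λ : Set ℝ) (c : ℝ → ℂ), IsAtomicMeasure μ Λ c) ∧
    ∃ (S : Set ℝ) (a : ℝ → ℂ), IsAtomicMeasure (𝓕 μ) S a

/-- `F(z) = ∑_{s ∈ S} p_s e^{2π i s z}`, absolutely convergent, in some upper half plane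
`Im z ≥ R`; the coefficients are put to be zero off `S`. -/
def HasUpperExpansion (F : ℂ → ℂ) (S : Set ℝ) (p : ℝ → ℂ) : Prop :=
  (∀ s, s ∉ S → p s = 0) ∧
    ∃ R : ℝ, 0 < R ∧ ∀ z : ℂ, R ≤ z.im →
      HasSum (fun s : S => p s * Complex.exp (2 * Real.pi * Complex.I * (s : ℝ) * z)) (F z)

/-- `F(z) = ∑_{s ∈ S} q_s e^{-2π i s z}`, absolutely convergent, in some lower half plane
`Im z ≤ -R`; the coefficients are put to be zero off `S`. -/
def HasLowerExpansion (F : ℂ → ℂ) (S : Set ℝ) (q : ℝ → ℂ) : Prop :=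
  (∀ s, s ∉ S → q s = 0) ∧
    ∃ R : ℝ, 0 < R ∧ ∀ z : ℂ, z.im ≤ -R →
      HasSum (fun s : S => q s * Complex.exp (-(2 * Real.pi * Complex.I * (s : ℝ) * z))) (F z)

/-- The masses `c_λ = ψ(λ) / φ'(λ)`. -/
def massCoeff (φ ψ : ℂ → ℂ) (x : ℝ) : ℂ := ψ (x : ℂ) / deriv φ (x : ℂ)

/-- The spectrum `S = S₋ ∪ (-S₊)`. -/
def spectrumSet (Sp Sm : Set ℝ) : Set ℝ := {s | s ∈ Sm ∨ -s ∈ Sp}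

/-- The amplitudes `a_s = (q_s - p_{-s}) / (2π i)`. -/
def amplitude (p q : ℝ → ℂ) (s : ℝ) : ℂ := (q s - p (-s)) / (2 * Real.pi * Complex.I)

end

/-! The formula is the residue theorem applied to ψf/φ, where f is the Fourier–Laplace transform of
a compactly supported C² function h. Such an f is entire and decays quadratically on horizontal
strips. Take rectangles [a, b] × [-R, R] whose vertical sides keep away from the zeros of φ. The
residues give 2πi ∑ c_λ f(λ), and the vertical sides contribute nothing in the limit. On Im z = ±R
the quotient ψ/φ is an absolutely convergent series of exponentials, and Fourier inversion along the
line turns each term into a value of h. What remains is ∑ a_s h(s) = ∑ c_λ f(λ)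
(`hasSum_residues_strip`, `hasSum_amplitude_of_hasCompactSupport`).

Two facts about exponential polynomials feed this. High in the upper half plane the term of lowest
frequency dominates φ, so 1/φ is a geometric series. Its frequencies lie in finitely many translates
of a semigroup with finitely many positive generators, hence the polynomial count
(`exists_hasUpperExpansion`; reflection gives the lower half plane). On a strip, |φ| is bounded
below away from its zeros, because real translations only rotate the coefficients and the rotations
form a compact torus (`exists_lower_bound_away_from_zeros`). This bounds ψ/φ on the contours and, by
the maximum principle, the masses c_λ.

To reach Schwartz functions, testing against a narrow bump around a single s shows that (a_s) is
bounded (`exists_bound_amplitudes`). Then 𝓕 f is truncated and dominated convergence is used on both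
sides (`hasSum_of_hasSum_hasCompactSupport`). Inserting 𝓕 f into the formula yields 𝓕 μ. -/

/-! ### Exponentials of real frequency and exponential sums. -/

/-- The exponential `e^{2π i s z}` of real frequency `s`. -/
noncomputable def wave (s : ℝ) (z : ℂ) : ℂ := Complex.exp (2 * Real.pi * Complex.I * s * z)

lemma norm_wave (s : ℝ) (z : ℂ) : ‖wave s z‖ = Real.exp (-(2 * Real.pi * s * z.im)) := by
  rw [wave, Complex.norm_exp]
  congr 1
  have : 2 * (Real.pi : ℂ) * Complex.I * s * z = ((2 * Real.pi * s : ℝ) : ℂ) * (Complex.I * z) := by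
    push_cast; ring
  rw [this, Complex.re_ofReal_mul]
  simp

lemma wave_ne_zero (s : ℝ) (z : ℂ) : wave s z ≠ 0 := Complex.exp_ne_zero _

lemma wave_add_freq (s t : ℝ) (z : ℂ) : wave (s + t) z = wave s z * wave t z := by
  rw [wave, wave, wave, ← Complex.exp_add]; push_cast; ring_nf

lemma wave_sub_freq (s t : ℝ) (z : ℂ) : wave (s - t) z = wave s z / wave t z := by
  rw [eq_div_iff (wave_ne_zero _ _), ← wave_add_freq, sub_add_cancel]

lemma wave_add_arg (s : ℝ) (z w : ℂ) : wave s (z + w) = wave s z * wave s w := by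
  rw [wave, wave, wave, ← Complex.exp_add]; ring_nf

lemma wave_neg_freq (s : ℝ) (z : ℂ) : wave (-s) z = wave s (-z) := by
  rw [wave, wave]; push_cast; ring_nf

lemma norm_wave_ofReal (s x : ℝ) : ‖wave s (x : ℂ)‖ = 1 := by simp [norm_wave]

lemma wave_sum_freq {n : ℕ} (s : Fin n → ℝ) (z : ℂ) :
    wave (∑ i, s i) z = ∏ i, wave (s i) z := by
  simp only [wave, ← Complex.exp_sum]
  congr 1
  push_cast
  rw [Finset.mul_sum, Finset.sum_mul]

@[fun_prop] lemma differentiable_wave (s : ℝ) : Differentiable ℂ (wave s) := by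
  unfold wave; fun_prop

@[fun_prop] lemma continuous_wave (s : ℝ) : Continuous (wave s) :=
  (differentiable_wave s).continuous

/-- The exponential polynomial with frequencies in `A` and coefficients `d`. -/
noncomputable def expSum (A : Finset ℝ) (d : ℝ → ℂ) (z : ℂ) : ℂ := ∑ a ∈ A, d a * wave a z

@[fun_prop] lemma differentiable_expSum (A : Finset ℝ) (d : ℝ → ℂ) :
    Differentiable ℂ (expSum A d) := by
  unfold expSum; fun_prop

@[fun_prop] lemma continuous_expSum (A : Finset ℝ) (d : ℝ → ℂ) : Continuous (expSum A d) :=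
  (differentiable_expSum A d).continuous

/-- Equal frequencies are merged and those whose coefficients cancel are dropped, so that the
extreme frequencies really occur; the dominant-term arguments depend on this. -/
lemma IsExpPoly.exists_expSum {ψ : ℂ → ℂ} (h : IsExpPoly ψ) :
    ∃ (A : Finset ℝ) (d : ℝ → ℂ), (∀ a ∈ A, d a ≠ 0) ∧ ψ = expSum A d := by
  classical
  obtain ⟨l, α, b, hψ⟩ := h
  set d : ℝ → ℂ := fun a => ∑ j with α j = a, b j with hd
  refine ⟨(Finset.univ.image α).filter (fun a => d a ≠ 0), d, by simp, ?_⟩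
  ext z
  rw [hψ, expSum, Finset.sum_filter_of_ne (by intro a _ h0 h1; simp [h1] at h0),
    ← Finset.sum_fiberwise_of_maps_to (g := α) (t := Finset.univ.image α) (by simp)]
  refine Finset.sum_congr rfl fun a _ => ?_
  rw [hd, Finset.sum_mul]
  refine Finset.sum_congr rfl fun j hj => ?_
  rw [← (Finset.mem_filter.1 hj).2]; rfl

/-- Reflection of frequencies gives reflection of the variable. -/
lemma expSum_neg (A : Finset ℝ) (d : ℝ → ℂ) (z : ℂ) :
    expSum A d (-z) = expSum (A.map (Equiv.neg ℝ).toEmbedding) (fun a => d (-a)) z := by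
  simp [expSum, wave_neg_freq]

lemma norm_expSum_le (A : Finset ℝ) (d : ℝ → ℂ) {R : ℝ} {z : ℂ} (hz : |z.im| ≤ R) :
    ‖expSum A d z‖ ≤ ∑ a ∈ A, ‖d a‖ * Real.exp (2 * Real.pi * |a| * R) := by
  refine (norm_sum_le _ _).trans (Finset.sum_le_sum fun a _ => ?_)
  rw [norm_mul, norm_wave]
  gcongr
  have := Real.pi_pos
  have h1 : -(a * z.im) ≤ |a| * R := by
    refine (neg_le_abs _).trans ?_
    rw [abs_mul]; gcongr
  nlinarith

/-! ### Polynomially growing sets of frequencies -/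

lemma HasPolynomialCount.union {S T : Set ℝ} (hS : HasPolynomialCount S)
    (hT : HasPolynomialCount T) : HasPolynomialCount (S ∪ T) := by
  obtain ⟨hS0, C, m, hS⟩ := hS
  obtain ⟨hT0, D, n, hT⟩ := hT
  refine ⟨fun r => by rw [Set.union_inter_distrib_right]; exact (hS0 r).union (hT0 r),
    |C| + |D|, m + n, fun r hr => ?_⟩
  rw [Set.union_inter_distrib_right]
  calc ((S ∩ Set.Ioo (-r) r ∪ T ∩ Set.Ioo (-r) r).ncard : ℝ)
      ≤ (S ∩ Set.Ioo (-r) r).ncard + (T ∩ Set.Ioo (-r) r).ncard := by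
        exact_mod_cast Set.ncard_union_le _ _
    _ ≤ |C| * r ^ (m + n) + |D| * r ^ (m + n) := by
        refine add_le_add ((hS r hr).trans ?_) ((hT r hr).trans ?_)
        · exact mul_le_mul (le_abs_self C) (pow_le_pow_right₀ hr.le (by omega)) (by positivity)
            (abs_nonneg _)
        · exact mul_le_mul (le_abs_self D) (pow_le_pow_right₀ hr.le (by omega)) (by positivity)
            (abs_nonneg _)
    _ = _ := by ring

lemma neg_inter_Ioo (S : Set ℝ) (r : ℝ) :
    (-S) ∩ Set.Ioo (-r) r = -(S ∩ Set.Ioo (-r) r) := by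
  ext x; simp only [Set.mem_inter_iff, Set.mem_neg, Set.mem_Ioo]
  constructor <;> rintro ⟨h, h1, h2⟩ <;> exact ⟨h, by linarith, by linarith⟩

lemma HasPolynomialCount.neg {S : Set ℝ} (hS : HasPolynomialCount S) :
    HasPolynomialCount (-S) := by
  obtain ⟨hS0, C, m, hS⟩ := hS
  refine ⟨fun r => by rw [neg_inter_Ioo]; exact (hS0 r).neg, C, m, fun r hr => ?_⟩
  rw [neg_inter_Ioo, ← Set.image_neg_eq_neg, Set.ncard_image_of_injective _ neg_injective]
  exact hS r hr

/-- All generators are at least some γ > 0, so an element below r uses each of them at most (r +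
M)/γ times, where M bounds the offsets. The degree of the count is the number of generators. -/
lemma hasPolynomialCount_of_subset_semigroup {ι κ : Type*} [Fintype ι] [Fintype κ]
    (β : ι → ℝ) (g : κ → ℝ) (hg : ∀ a, 0 < g a) {S : Set ℝ}
    (hS : ∀ s ∈ S, ∃ (b : ι) (k : κ → ℕ), s = β b + ∑ a, k a * g a) :
    HasPolynomialCount S := by
  classical
  obtain ⟨γ, hγ, hγg⟩ : ∃ γ : ℝ, 0 < γ ∧ ∀ a, γ ≤ g a := by
    rcases isEmpty_or_nonempty κ with h | h
    · exact ⟨1, one_pos, fun a => (IsEmpty.false a).elim⟩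
    · obtain ⟨a, ha⟩ := Finite.exists_min g
      exact ⟨g a, hg a, ha⟩
  set M : ℝ := ∑ b, |β b|
  have hM : ∀ b, |β b| ≤ M := fun b =>
    Finset.single_le_sum (f := fun b => |β b|) (fun _ _ => abs_nonneg _) (Finset.mem_univ b)
  have hM0 : 0 ≤ M := Finset.sum_nonneg fun _ _ => abs_nonneg _
  have key : ∀ r : ℝ, S ∩ Set.Ioo (-r) r ⊆
      ((Finset.univ ×ˢ Fintype.piFinset
        (fun _ : κ => Finset.range (⌊(r + M) / γ⌋₊ + 1))).image
        (fun x : ι × (κ → ℕ) => β x.1 + ∑ a, x.2 a * g a) : Finset ℝ) := by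
    rintro r s ⟨hs, -, hr⟩
    obtain ⟨b, k, rfl⟩ := hS s hs
    simp only [Finset.coe_image, Set.mem_image, Finset.mem_coe, Finset.mem_product,
      Finset.mem_univ, Fintype.mem_piFinset, Finset.mem_range, true_and]
    refine ⟨(b, k), fun a => ?_, rfl⟩
    have h1 : (k a : ℝ) * γ ≤ ∑ a, k a * g a :=
      (mul_le_mul_of_nonneg_left (hγg a) (Nat.cast_nonneg _)).trans
        (Finset.single_le_sum (f := fun a => (k a : ℝ) * g a)
          (fun a _ => mul_nonneg (Nat.cast_nonneg _) (hg a).le) (Finset.mem_univ a))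
    have h2 := (abs_le.1 (hM b)).1
    refine Nat.lt_succ_of_le (Nat.le_floor ?_)
    rw [le_div_iff₀ hγ]
    linarith
  refine ⟨fun r => (Finset.finite_toSet _).subset (key r),
    Fintype.card ι * ((1 + M) / γ + 1) ^ Fintype.card κ, Fintype.card κ, fun r hr => ?_⟩
  have h0 : 0 ≤ (r + M) / γ := by positivity
  calc ((S ∩ Set.Ioo (-r) r).ncard : ℝ)
      ≤ (Fintype.card ι * (⌊(r + M) / γ⌋₊ + 1) ^ Fintype.card κ : ℕ) := by
        have := (Set.ncard_le_ncard (key r) (Finset.finite_toSet _)).trans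
          ((Set.ncard_coe_finset _).trans_le Finset.card_image_le)
        rw [Finset.card_product, Fintype.card_piFinset] at this
        exact_mod_cast this.trans (by simp)
    _ = Fintype.card ι * ((⌊(r + M) / γ⌋₊ : ℝ) + 1) ^ Fintype.card κ := by push_cast; rfl
    _ ≤ Fintype.card ι * (((1 + M) / γ + 1) * r) ^ Fintype.card κ := by
        gcongr
        have h1 := Nat.floor_le h0
        have h2 : (r + M) / γ ≤ (1 + M) / γ * r := by
          rw [div_mul_eq_mul_div]; gcongr; nlinarith
        nlinarith
    _ = _ := by rw [mul_pow]; ring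

/-! ### Expansion of a quotient in an upper half plane -/

/-- Several indices may carry the same frequency; absolute convergence allows summing over the
fibres of `ν`. -/
lemma hasUpperExpansion_of_hasSum {ι : Type*} (c : ι → ℂ) (ν : ι → ℝ) {G : ℂ → ℂ} {R : ℝ}
    (hR : 0 < R) (h : ∀ z : ℂ, R ≤ z.im → HasSum (fun i => c i * wave (ν i) z) (G z)) :
    HasUpperExpansion G (Set.range ν) (fun s => ∑' i : {i // ν i = s}, c i) := by
  have hoff : ∀ s, s ∉ Set.range ν → ∑' i : {i // ν i = s}, c i = 0 := by
    intro s hs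
    have : IsEmpty {i // ν i = s} := ⟨fun i => hs ⟨i, i.2⟩⟩
    exact tsum_empty
  refine ⟨hoff, R, hR, fun z hz => ?_⟩
  have h1 : HasSum ((fun i => c i * wave (ν i) z) ∘ (Equiv.sigmaFiberEquiv ν)) (G z) :=
    (Equiv.hasSum_iff _).2 (h z hz)
  have h2 : ∀ s : ℝ, HasSum (fun i : {i // ν i = s} => c i * wave (ν i) z)
      ((∑' i : {i // ν i = s}, c i) * wave s z) := by
    intro s
    have h3 : Summable (fun i : {i // ν i = s} => c i * wave (ν i) z) := h1.summable.sigma_factor s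
    have h4 : (fun i : {i // ν i = s} => c i * wave (ν i) z) =
        fun i : {i // ν i = s} => c i * wave s z := by
      ext i; rw [i.2]
    rw [h4] at h3 ⊢
    exact ((summable_mul_right_iff (wave_ne_zero s z)).1 h3).hasSum.mul_right _
  have h5 := h1.sigma h2
  rw [← hasSum_subtype_iff_of_support_subset (s := Set.range ν)] at h5
  · exact h5
  · intro s hs
    by_contra hs'
    exact hs (by simp only [hoff s hs', zero_mul])

/-- The geometric series with each power multiplied out. Indexing by words instead of exponent
vectors avoids multinomial coefficients. -/
lemma hasSum_words {κ : Type*} [Fintype κ] (x : κ → ℂ) (hx : ∑ a, ‖x a‖ < 1) :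
    HasSum (fun w : Σ n : ℕ, (Fin n → κ) => ∏ i, x (w.2 i)) (1 - ∑ a, x a)⁻¹ := by
  classical
  have hs : Summable (fun w : Σ n : ℕ, (Fin n → κ) => ∏ i, x (w.2 i)) := by
    refine Summable.of_norm ?_
    simp only [norm_prod]
    refine (summable_sigma_of_nonneg fun w => by positivity).2 ⟨fun n => Summable.of_finite, ?_⟩
    have : ∀ n : ℕ, ∑' w : Fin n → κ, ∏ i, ‖x (w i)‖ = (∑ a, ‖x a‖) ^ n := by
      intro n; rw [tsum_fintype, Fintype.sum_pow]
    simp only [this]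
    exact summable_geometric_of_lt_one (by positivity) hx
  refine HasSum.sigma_of_hasSum (g := fun n => (∑ a, x a) ^ n)
    (hasSum_geometric_of_norm_lt_one ((norm_sum_le _ _).trans_lt hx)) (fun n => ?_) hs
  rw [Fintype.sum_pow]
  exact hasSum_fintype _

lemma exists_pos_sum_exp_lt {κ : Type*} [Fintype κ] (C : κ → ℝ) (g : κ → ℝ)
    (hg : ∀ a, 0 < g a) {η : ℝ} (hη : 0 < η) :
    ∃ R : ℝ, 0 < R ∧ ∑ a, C a * Real.exp (-(2 * Real.pi * g a * R)) < η := by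
  have h : Filter.Tendsto (fun R : ℝ => ∑ a, C a * Real.exp (-(2 * Real.pi * g a * R)))
      Filter.atTop (nhds (∑ a, C a * 0)) := by
    refine tendsto_finsetSum _ fun a _ => Filter.Tendsto.const_mul _ ?_
    refine Real.tendsto_exp_neg_atTop_nhds_zero.comp ?_
    have := hg a
    exact Filter.tendsto_id.const_mul_atTop (by positivity)
  simp only [mul_zero, Finset.sum_const_zero] at h
  obtain ⟨R, h1, h2⟩ := ((h.eventually_lt_const hη).and (Filter.eventually_gt_atTop 0)).exists
  exact ⟨R, h2, h1⟩

/-- The remaining waves have positive frequencies relative to the lowest one, hence decay as Im z →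
∞; the bracket is then inverted by `hasSum_words`. -/
lemma expSum_eq_min_mul {A : Finset ℝ} (hA : A.Nonempty) (d : ℝ → ℂ)
    (hd : d (A.min' hA) ≠ 0) (z : ℂ) :
    expSum A d z = d (A.min' hA) * wave (A.min' hA) z *
      (1 - ∑ a : A.erase (A.min' hA),
        -(d a / d (A.min' hA)) * wave (a - A.min' hA) z) := by
  set a₀ := A.min' hA
  rw [Finset.sum_coe_sort (A.erase a₀) (fun a => -(d a / d a₀) * wave (a - a₀) z), expSum,
    ← Finset.add_sum_erase A _ (A.min'_mem hA)]
  simp only [neg_mul, Finset.sum_neg_distrib, sub_neg_eq_add, mul_add, mul_one, Finset.mul_sum]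
  congr 1
  refine Finset.sum_congr rfl fun a _ => ?_
  rw [wave_sub_freq]
  field_simp [wave_ne_zero]

lemma min'_lt_of_mem_erase {A : Finset ℝ} (hA : A.Nonempty) (a : A.erase (A.min' hA)) :
    0 < (a : ℝ) - A.min' hA :=
  sub_pos.2 (A.min'_lt_of_mem_erase_min' hA a.2)

theorem exists_hasUpperExpansion {A : Finset ℝ} (hA : A.Nonempty) {d : ℝ → ℂ}
    (hd : ∀ a ∈ A, d a ≠ 0) (B : Finset ℝ) (e : ℝ → ℂ) :
    ∃ (S : Set ℝ) (p : ℝ → ℂ),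
      HasUpperExpansion (fun z => expSum B e z / expSum A d z) S p ∧ HasPolynomialCount S := by
  classical
  set a₀ := A.min' hA with ha₀
  have hd₀ : d a₀ ≠ 0 := hd _ (A.min'_mem hA)
  have hgap : ∀ a : A.erase a₀, 0 < (a : ℝ) - a₀ := min'_lt_of_mem_erase hA
  obtain ⟨R, hR, hR1⟩ := exists_pos_sum_exp_lt (fun a : A.erase a₀ => ‖d a / d a₀‖)
    (fun a => (a : ℝ) - a₀) hgap one_pos
  set ν : B × (Σ n : ℕ, (Fin n → A.erase a₀)) → ℝ :=
    fun i => ((i.1 : ℝ) - a₀) + ∑ j, ((i.2.2 j : ℝ) - a₀) with hν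
  set c : B × (Σ n : ℕ, (Fin n → A.erase a₀)) → ℂ :=
    fun i => (e i.1 / d a₀) * ∏ j, -(d (i.2.2 j) / d a₀) with hc
  refine ⟨Set.range ν, _, hasUpperExpansion_of_hasSum c ν hR fun z hz => ?_, ?_⟩
  · have hlt : ∑ a : A.erase a₀, ‖-(d a / d a₀) * wave (a - a₀) z‖ < 1 := by
      refine lt_of_le_of_lt (Finset.sum_le_sum fun a _ => ?_) hR1
      rw [norm_mul, norm_neg, norm_wave]
      have := hgap a
      gcongr
    have h1 := hasSum_words _ hlt
    set f : B → ℂ := fun b => e b / d a₀ * wave (b - a₀) z with hf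
    set g : (Σ n : ℕ, (Fin n → A.erase a₀)) → ℂ :=
      fun w => ∏ i, -(d (w.2 i) / d a₀) * wave (w.2 i - a₀) z with hg
    have h2 : HasSum f (∑ b, f b) := hasSum_fintype f
    have h4 : Summable (fun x : B × (Σ n : ℕ, (Fin n → A.erase a₀)) => f x.1 * g x.2) :=
      summable_mul_of_summable_norm h2.summable.norm h1.summable.norm
    have h3 := HasSum.mul h2 h1 h4
    have h5 : (fun i => c i * wave (ν i) z) = fun x => f x.1 * g x.2 := by
      ext i
      simp only [hc, hν, hf, hg, wave_add_freq, wave_sum_freq, Finset.prod_mul_distrib]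
      ring
    have h6 : expSum B e z / expSum A d z = (∑ b, f b) *
        (1 - ∑ a : A.erase a₀, -(d a / d a₀) * wave (a - a₀) z)⁻¹ := by
      rw [expSum_eq_min_mul hA d hd₀, ← ha₀, hf, Finset.sum_coe_sort B (fun b => e b / d a₀ * wave (b - a₀) z), expSum]
      simp only [wave_sub_freq _ a₀]
      rw [div_eq_mul_inv, mul_inv, ← mul_assoc, Finset.sum_mul]
      congr 1
      refine Finset.sum_congr rfl fun b _ => ?_
      field_simp [wave_ne_zero]
    rw [h5]
    simp only [h6]
    exact h3
  · refine hasPolynomialCount_of_subset_semigroup (fun b : B => (b : ℝ) - a₀)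
      (fun a : A.erase a₀ => (a : ℝ) - a₀) hgap ?_
    rintro _ ⟨⟨b, n, w⟩, rfl⟩
    -- The frequency of a word depends only on how often each letter occurs.
    refine ⟨b, fun a => (Finset.univ.filter fun j => w j = a).card, ?_⟩
    simp only [hν]
    congr 1
    rw [← Finset.sum_fiberwise Finset.univ w]
    refine Finset.sum_congr rfl fun a _ => ?_
    rw [Finset.sum_congr rfl (g := fun _ => (a : ℝ) - a₀)
      (by intro j hj; rw [(Finset.mem_filter.1 hj).2]), Finset.sum_const, nsmul_eq_mul]

theorem exists_hasLowerExpansion {A : Finset ℝ} (hA : A.Nonempty) {d : ℝ → ℂ}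
    (hd : ∀ a ∈ A, d a ≠ 0) (B : Finset ℝ) (e : ℝ → ℂ) :
    ∃ (S : Set ℝ) (q : ℝ → ℂ),
      HasLowerExpansion (fun z => expSum B e z / expSum A d z) S q ∧ HasPolynomialCount S := by
  obtain ⟨S, q, ⟨h0, R, hR, h⟩, hS⟩ := exists_hasUpperExpansion
    (A := A.map (Equiv.neg ℝ).toEmbedding) (by simpa using hA) (d := fun a => d (-a))
    (by
      intro a ha
      obtain ⟨b, hb, rfl⟩ := Finset.mem_map.1 ha
      simpa using hd b hb) (B.map (Equiv.neg ℝ).toEmbedding) (fun b => e (-b))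
  refine ⟨S, q, ⟨h0, R, hR, fun z hz => ?_⟩, hS⟩
  have := h (-z) (by simp; linarith)
  simp only [← expSum_neg, neg_neg, mul_neg] at this
  exact this

/-! ### Lower bounds for exponential polynomials away from their zeros -/

/-- Far up the imaginary axis the lowest frequency outweighs all the others together. -/
lemma exists_expSum_ne_zero {A : Finset ℝ} (hA : A.Nonempty) {d : ℝ → ℂ}
    (hd : ∀ a ∈ A, d a ≠ 0) : ∃ z, expSum A d z ≠ 0 := by
  set a₀ := A.min' hA
  have hd₀ : d a₀ ≠ 0 := hd _ (A.min'_mem hA)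
  obtain ⟨R, -, hR1⟩ := exists_pos_sum_exp_lt (fun a : A.erase a₀ => ‖d a / d a₀‖)
    (fun a => (a : ℝ) - a₀) (min'_lt_of_mem_erase hA) one_pos
  refine ⟨R * Complex.I, ?_⟩
  rw [expSum_eq_min_mul hA d hd₀]
  refine mul_ne_zero (mul_ne_zero hd₀ (wave_ne_zero _ _)) (sub_ne_zero.2 fun h => ?_)
  have h1 := norm_sum_le Finset.univ
    (fun a : A.erase a₀ => -(d a / d a₀) * wave (a - a₀) (R * Complex.I))
  rw [← h, norm_one] at h1
  refine absurd hR1 (not_lt.2 (h1.trans (Finset.sum_le_sum fun a _ => ?_)))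
  rw [norm_mul, norm_neg, norm_wave]
  simp

lemma exists_sphere_ne_zero {g : ℂ → ℂ} (hg : Differentiable ℂ g) (h0 : ∃ z, g z ≠ 0) {ε : ℝ}
    (hε : 0 < ε) : ∃ r, 0 < r ∧ r < ε ∧ ∀ w ∈ Metric.sphere (0 : ℂ) r, g w ≠ 0 := by
  have han : AnalyticOnNhd ℂ g Set.univ := fun z _ => hg.analyticAt z
  rcases (hg.analyticAt 0).eventually_eq_zero_or_eventually_ne_zero with h | h
  · obtain ⟨z, hz⟩ := h0
    exact absurd (congrFun (han.eq_of_eventuallyEq (g := fun _ => 0)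
      (fun z _ => analyticAt_const) h) z) hz
  · rw [eventually_nhdsWithin_iff, Metric.eventually_nhds_iff] at h
    obtain ⟨ρ, hρ, h⟩ := h
    refine ⟨min ρ ε / 2, by positivity, ?_, fun w hw => ?_⟩
    · linarith [min_le_right ρ ε, lt_min hρ hε]
    · have hp : 0 < min ρ ε := lt_min hρ hε
      have hw' : dist w 0 = min ρ ε / 2 := hw
      refine h (by linarith [min_le_left ρ ε]) ?_
      rintro rfl
      simp at hw'
      linarith

/-- A quantitative form of Hurwitz's theorem. -/
lemma exists_zero_of_sphere_bound {g : ℂ → ℂ} (hg : Differentiable ℂ g) {r m : ℝ} (hr : 0 < r)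
    (hm : 0 < m) (hs : ∀ w ∈ Metric.sphere (0 : ℂ) r, m ≤ ‖g w‖) (h0 : ‖g 0‖ < m / 4) :
    ∃ w, ‖w‖ ≤ r ∧ g w = 0 := by
  have hs' : ∀ w ∈ Metric.sphere (0 : ℂ) r, m / 2 ≤ ‖g w - g 0‖ := by
    intro w hw
    have h1 := hs w hw
    have h2 := norm_sub_norm_le (g w) (g 0)
    linarith
  -- If `g` were constant near 0 it would be constant everywhere, against `hs'`.
  have hfreq : ∃ᶠ z in nhds (0 : ℂ), g z ≠ g 0 := by
    intro h
    have h : g =ᶠ[nhds 0] fun _ => g 0 := by filter_upwards [h] with z hz; simpa using hz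
    have h1 := AnalyticOnNhd.eq_of_eventuallyEq (fun z _ => hg.analyticAt z)
      (fun z _ => analyticAt_const) h
    have h2 := hs' (r : ℂ) (by simp [abs_of_pos hr])
    rw [h1, sub_self, norm_zero] at h2
    linarith
  -- Quantitative open mapping: the image of the disc contains the ball about `g 0` of half the
  -- radius bounding `g w - g 0` from below on the circle, whence m/4.
  obtain ⟨w, hw, hw0⟩ := hg.diffContOnCl.ball_subset_image_closedBall hr hs' hfreq
    (show (0 : ℂ) ∈ Metric.ball (g 0) (m / 2 / 2) by
      rw [Metric.mem_ball, dist_zero_left]; linarith)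
  exact ⟨w, by simpa using hw, hw0⟩

/-- Almost periodicity as compactness: every translate of φ belongs to the family with coefficients
twisted by unimodular phases, compact by Tychonoff. Near each member, Hurwitz's theorem gives the
alternative "bounded below at 0, or a zero within ε", and finitely many neighbourhoods suffice. -/
theorem exists_lower_bound_away_from_zeros {A : Finset ℝ} (hA : A.Nonempty) {d : ℝ → ℂ}
    (hd : ∀ a ∈ A, d a ≠ 0) (R : ℝ) {ε : ℝ} (hε : 0 < ε) :
    ∃ m : ℝ, 0 < m ∧ ∀ z : ℂ, |z.im| ≤ R →
      (∀ w, expSum A d w = 0 → ε ≤ dist z w) → m ≤ ‖expSum A d z‖ := by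
  set T : Set (ℝ → ℂ) := Set.univ.pi fun _ => Metric.sphere 0 1
  -- The parameter `κ` consists of the phases and the height in the strip.
  set Φ : (ℝ → ℂ) × ℝ → ℂ → ℂ :=
    fun κ w => expSum A (fun a => d a * κ.1 a) (κ.2 * Complex.I + w) with hΦ
  have hΦc : Continuous (fun x : ((ℝ → ℂ) × ℝ) × ℂ => Φ x.1 x.2) := by
    simp only [hΦ, expSum, wave]
    fun_prop
  have hΦd : ∀ κ, Differentiable ℂ (Φ κ) := fun κ => by
    simp only [hΦ]
    fun_prop
  have hK : IsCompact (T ×ˢ Set.Icc (-R) R) :=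
    (isCompact_univ_pi fun _ => isCompact_sphere _ _).prod isCompact_Icc
  obtain ⟨m, hm, h⟩ : ∃ m : ℝ, 0 < m ∧ ∀ κ ∈ T ×ˢ Set.Icc (-R) R,
      m ≤ ‖Φ κ 0‖ ∨ ∃ w, ‖w‖ < ε ∧ Φ κ w = 0 := by
    refine hK.induction_on (p := fun s => ∃ m : ℝ, 0 < m ∧ ∀ κ ∈ s,
      m ≤ ‖Φ κ 0‖ ∨ ∃ w, ‖w‖ < ε ∧ Φ κ w = 0) ⟨1, one_pos, by simp⟩ ?_ ?_ ?_
    · rintro s t hst ⟨m, hm, h⟩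
      exact ⟨m, hm, fun κ hκ => h κ (hst hκ)⟩
    · rintro s t ⟨m, hm, h⟩ ⟨n, hn, h'⟩
      refine ⟨min m n, lt_min hm hn, fun κ hκ => ?_⟩
      rcases hκ with hκ | hκ
      · exact (h κ hκ).imp_left (min_le_left _ _).trans
      · exact (h' κ hκ).imp_left (min_le_right _ _).trans
    · rintro κ ⟨hκ, -⟩
      have hne : ∃ w, Φ κ w ≠ 0 := by
        obtain ⟨z, hz⟩ := exists_expSum_ne_zero hA (d := fun a => d a * κ.1 a) fun a ha =>
          mul_ne_zero (hd a ha) (by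
            have : κ.1 a ∈ Metric.sphere (0 : ℂ) 1 := hκ a (Set.mem_univ a)
            intro h; simp [h] at this)
        exact ⟨z - κ.2 * Complex.I, by simpa [hΦ] using hz⟩
      obtain ⟨r, hr, hrε, hs⟩ := exists_sphere_ne_zero (hΦd κ) hne hε
      obtain ⟨w₀, hw₀, hmin⟩ := (isCompact_sphere (0 : ℂ) r).exists_isMinOn
        (NormedSpace.sphere_nonempty.2 hr.le) (hΦd κ).continuous.norm.continuousOn
      -- Half of the minimum on the circle, so that the bound persists for nearby parameters.
      set m := ‖Φ κ w₀‖ / 2 with hmdef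
      have hm : 0 < m := by have := norm_pos_iff.2 (hs w₀ hw₀); positivity
      have hev : ∀ᶠ κ' in nhds κ, ∀ w ∈ Metric.sphere (0 : ℂ) r, m < ‖Φ κ' w‖ := by
        refine (isCompact_sphere (0 : ℂ) r).eventually_forall_of_forall_eventually fun w hw => ?_
        have h1 : m < ‖Φ κ w‖ := by
          have : ‖Φ κ w₀‖ ≤ ‖Φ κ w‖ := hmin hw
          linarith
        exact (hΦc.norm.tendsto (κ, w)).eventually_const_lt h1
      refine ⟨_, mem_nhdsWithin_of_mem_nhds hev, m / 4, by positivity, fun κ' hκ' => ?_⟩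
      refine or_iff_not_imp_left.2 fun hlt => ?_
      obtain ⟨w, hw, hw0⟩ := exists_zero_of_sphere_bound (hΦd κ') hr hm
        (fun w hw => (hκ' w hw).le) (not_le.1 hlt)
      exact ⟨w, hw.trans_lt hrε, hw0⟩
  refine ⟨m, hm, fun z hz hzero => ?_⟩
  -- At the phases `wave a z.re` the twisted function is the actual translate of φ by z.
  have hshift : ∀ w, Φ (fun a => wave a z.re, z.im) w = expSum A d (z + w) := by
    intro w
    simp only [hΦ, expSum, mul_assoc, ← wave_add_arg]
    rw [← add_assoc, Complex.re_add_im]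
  rcases h (fun a => wave a z.re, z.im)
    ⟨fun a _ => by simp [norm_wave_ofReal], abs_le.1 hz⟩ with h1 | ⟨w, hw, hw0⟩
  · simpa [hshift] using h1
  · rw [hshift] at hw0
    have := hzero _ hw0
    rw [dist_self_add_right] at this
    linarith

/-- The quotient of two exponential polynomials is bounded on a strip away from the poles. -/
theorem exists_bound_div_away_from_zeros {A : Finset ℝ} (hA : A.Nonempty) {d : ℝ → ℂ}
    (hd : ∀ a ∈ A, d a ≠ 0) (B : Finset ℝ) (e : ℝ → ℂ) (R : ℝ) {ε : ℝ} (hε : 0 < ε) :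
    ∃ M : ℝ, 0 ≤ M ∧ ∀ z : ℂ, |z.im| ≤ R →
      (∀ w, expSum A d w = 0 → ε ≤ dist z w) → ‖expSum B e z / expSum A d z‖ ≤ M := by
  obtain ⟨m, hm, h⟩ := exists_lower_bound_away_from_zeros hA hd R hε
  refine ⟨(∑ a ∈ B, ‖e a‖ * Real.exp (2 * Real.pi * |a| * R)) / m, by positivity,
    fun z hz hw => ?_⟩
  rw [norm_div]
  gcongr
  · exact norm_expSum_le B e hz
  · exact h z hz hw

/-- The residues of the quotient are bounded if the poles are separated. -/
theorem norm_div_deriv_le {φ ψ : ℂ → ℂ} (hφ : Differentiable ℂ φ) (hψ : Differentiable ℂ ψ)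
    {a : ℂ} (ha : φ a = 0) (ha' : deriv φ a ≠ 0) {r M : ℝ} (hr : 0 < r)
    (hz : ∀ z, dist z a ≤ r → z ≠ a → φ z ≠ 0)
    (hM : ∀ z, dist z a = r → ‖ψ z / φ z‖ ≤ M) : ‖ψ a / deriv φ a‖ ≤ M * r := by
  have hfac : ∀ z, φ z = (z - a) * dslope φ a z := fun z => by
    have := sub_smul_dslope φ a z
    simp only [smul_eq_mul, ha, sub_zero] at this
    exact this.symm
  have hds : Differentiable ℂ (dslope φ a) := by
    rw [← differentiableOn_univ] at hφ ⊢
    exact (Complex.differentiableOn_dslope Filter.univ_mem).2 hφ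
  have hne : ∀ z ∈ Metric.closedBall a r, dslope φ a z ≠ 0 := by
    intro z hz'
    rcases eq_or_ne z a with rfl | h
    · simpa using ha'
    · intro h0
      exact hz z hz' h (by rw [hfac, h0, mul_zero])
  have h1 : DiffContOnCl ℂ (fun z => ψ z / dslope φ a z) (Metric.ball a r) :=
    DifferentiableOn.diffContOnCl_ball (U := Metric.closedBall a r)
      (hψ.differentiableOn.div hds.differentiableOn hne) subset_rfl
  -- On the circle `ψ / dslope φ a` equals (z - a)ψ/φ, of norm at most M r; at the centre it is the
  -- residue.
  have h2 := Complex.norm_le_of_forall_mem_frontier_norm_le Metric.isBounded_ball h1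
    (C := M * r) (fun z hz' => ?_) (subset_closure (Metric.mem_ball_self hr))
  · simpa using h2
  · rw [frontier_ball _ hr.ne'] at hz'
    have hz'' : dist z a = r := hz'
    have := hM z hz''
    rw [hfac, div_mul_eq_div_div_swap, norm_div] at this
    rw [dist_eq_norm] at hz''
    rwa [hz'', div_le_iff₀ hr] at this

/-! ### Sums over uniformly discrete sets and over sets of polynomial growth -/

/-- Each term is compared with the integral over an interval of length δ about its point. These
intervals are disjoint and the total integral is π for every ε. This uniformity in ε is what later
bounds the amplitudes. -/
theorem IsUniformlyDiscrete.exists_sum_le {Λ : Set ℝ} (hΛ : IsUniformlyDiscrete Λ) :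
    ∃ K : ℝ, 0 ≤ K ∧ ∀ ε : ℝ, 0 < ε → ε ≤ 1 → ∀ u : Finset Λ,
      ∑ x ∈ u, ε * (1 + (ε * (x : ℝ)) ^ 2)⁻¹ ≤ K := by
  obtain ⟨δ, hδ, hsep⟩ := hΛ
  refine ⟨(2 + δ ^ 2 / 2) / δ * Real.pi, by positivity, fun ε hε hε1 u => ?_⟩
  set I : Λ → Set ℝ := fun x => Set.Ioo (x - δ / 2) (x + δ / 2)
  have hint : MeasureTheory.Integrable (fun t : ℝ => ε * (1 + (ε * t) ^ 2)⁻¹) :=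
    (integrable_inv_one_add_sq.comp_mul_left' hε.ne').const_mul ε
  have htot : ∫ t : ℝ, ε * (1 + (ε * t) ^ 2)⁻¹ = Real.pi := by
    rw [MeasureTheory.integral_const_mul,
      MeasureTheory.Measure.integral_comp_mul_left (fun t : ℝ => (1 + t ^ 2)⁻¹) ε,
      integral_univ_inv_one_add_sq, abs_of_pos (inv_pos.2 hε), smul_eq_mul, ← mul_assoc,
      mul_inv_cancel₀ hε.ne', one_mul]
  have hdisj : Set.PairwiseDisjoint (u : Set Λ) I := by
    intro x _ y _ hxy
    refine Set.disjoint_left.2 fun t ht ht' => ?_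
    have h1 := hsep x x.2 y y.2 (fun h => hxy (Subtype.ext h))
    rw [Real.dist_eq] at h1
    have h2 : |(x : ℝ) - y| < δ := abs_lt.2
      ⟨by linarith [ht.1, ht.2, ht'.1, ht'.2], by linarith [ht.1, ht.2, ht'.1, ht'.2]⟩
    linarith
  have hpt : ∀ x : Λ, ε * (1 + (ε * (x : ℝ)) ^ 2)⁻¹ * δ ≤
      (2 + δ ^ 2 / 2) * ∫ t in I x, ε * (1 + (ε * t) ^ 2)⁻¹ := by
    intro x
    -- For |t - x| ≤ δ/2, t² ≤ 2x² + δ²/2; with ε ≤ 1 this gives 1 + (εt)² ≤ (2 + δ²/2)(1 + (εx)²).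
    have h1 : ∀ t ∈ I x, ε * (1 + (ε * (x : ℝ)) ^ 2)⁻¹ / (2 + δ ^ 2 / 2) ≤
        ε * (1 + (ε * t) ^ 2)⁻¹ := by
      intro t ht
      rw [mul_div_assoc]
      refine mul_le_mul_of_nonneg_left ?_ hε.le
      rw [div_eq_mul_inv, ← mul_inv]
      refine inv_anti₀ (by positivity) ?_
      have h2 : (t - x) ^ 2 ≤ (δ / 2) ^ 2 :=
        sq_le_sq' (by linarith [ht.1]) (by linarith [ht.2])
      have h3 : t ^ 2 ≤ 2 * (x : ℝ) ^ 2 + δ ^ 2 / 2 := by nlinarith [sq_nonneg (t - 2 * x)]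
      have h4 : ε ^ 2 ≤ 1 := by nlinarith
      nlinarith [mul_le_mul_of_nonneg_left h3 (sq_nonneg ε), sq_nonneg (ε * x),
        mul_nonneg (sq_nonneg (ε * x)) (sq_nonneg δ),
        mul_le_mul_of_nonneg_right h4 (sq_nonneg δ)]
    have h2 := MeasureTheory.setIntegral_mono_on (μ := MeasureTheory.volume) (s := I x)
      (MeasureTheory.integrableOn_const (by simp [I])) hint.integrableOn measurableSet_Ioo h1
    rw [MeasureTheory.setIntegral_const, smul_eq_mul, Real.volume_real_Ioo_of_le (by linarith),
      show (x : ℝ) + δ / 2 - (x - δ / 2) = δ by ring, mul_div_assoc', div_le_iff₀ (by positivity)]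
      at h2
    linarith
  have h1 : ∑ x ∈ u, ∫ t in I x, ε * (1 + (ε * t) ^ 2)⁻¹ ≤ Real.pi := by
    rw [← MeasureTheory.integral_biUnion_finset u (fun _ _ => measurableSet_Ioo) hdisj
      (fun _ _ => hint.integrableOn), ← htot]
    exact MeasureTheory.setIntegral_le_integral hint
      (Filter.Eventually.of_forall fun t => by dsimp; positivity)
  have h2 := Finset.sum_le_sum (s := u) fun x _ => hpt x
  rw [← Finset.sum_mul, ← Finset.mul_sum u _ (2 + δ ^ 2 / 2)] at h2
  rw [div_mul_eq_mul_div, le_div_iff₀ hδ]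
  exact h2.trans (mul_le_mul_of_nonneg_left h1 (by positivity))

lemma IsUniformlyDiscrete.summable_inv_one_add_sq {Λ : Set ℝ} (hΛ : IsUniformlyDiscrete Λ) :
    Summable (fun x : Λ => (1 + (x : ℝ) ^ 2)⁻¹) := by
  obtain ⟨K, -, hK⟩ := hΛ.exists_sum_le
  exact summable_of_sum_le (fun x => by dsimp; positivity)
    fun u => by simpa using hK 1 one_pos le_rfl u

lemma IsUniformlyDiscrete.isLocallyFiniteSet {Λ : Set ℝ} (hΛ : IsUniformlyDiscrete Λ) :
    IsLocallyFiniteSet Λ := by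
  intro r
  have h := hΛ.summable_inv_one_add_sq.tendsto_cofinite_zero.eventually_lt_const
    (show (0 : ℝ) < (1 + r ^ 2)⁻¹ by positivity)
  have hfin : {x : Λ | ¬ (1 + (x : ℝ) ^ 2)⁻¹ < (1 + r ^ 2)⁻¹}.Finite := h
  refine (hfin.image Subtype.val).subset ?_
  rintro x ⟨hx, h1, h2⟩
  refine ⟨⟨x, hx⟩, not_lt.2 ?_, rfl⟩
  exact inv_anti₀ (by positivity) (by nlinarith)

/-- The shell n ≤ |s| < n + 1 has O((n + 1)^m) points, each of weight at most (n + 1)^{-(m+2)}. -/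
theorem HasPolynomialCount.exists_summable {S : Set ℝ} (hS : HasPolynomialCount S) :
    ∃ N : ℕ, Summable (fun s : S => ((1 + |(s : ℝ)|) ^ N)⁻¹) := by
  classical
  obtain ⟨hfin, C, m, hC⟩ := hS
  refine ⟨m + 2, ?_⟩
  have hsum : Summable (fun n : ℕ => |C| * 2 ^ m * (((n : ℝ) + 1) ^ 2)⁻¹) := by
    refine Summable.mul_left _ ?_
    have := (summable_nat_add_iff 1).2 (Real.summable_nat_pow_inv (p := 2).2 one_lt_two)
    simpa using this
  refine summable_of_sum_le (fun s => by dsimp; positivity)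
    (c := ∑' n : ℕ, |C| * 2 ^ m * (((n : ℝ) + 1) ^ 2)⁻¹) fun u => ?_
  set k : S → ℕ := fun s => ⌊|(s : ℝ)|⌋₊
  rw [← Finset.sum_fiberwise_of_maps_to (g := k) (t := u.image k)
    (fun s hs => Finset.mem_image_of_mem k hs)]
  refine le_trans (Finset.sum_le_sum fun n _ => ?_)
    (hsum.sum_le_tsum (u.image k) fun n _ => by positivity)
  have hcard : ((u.filter fun s => k s = n).card : ℝ) ≤ |C| * 2 ^ m * ((n : ℝ) + 1) ^ m := by
    -- Radius n + 2 rather than n + 1, since the count is only available for r > 1 and n may be 0; n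
    -- + 2 ≤ 2(n + 1) produces the factor 2^m.
    have h1 : ((u.filter fun s => k s = n).card : ℝ) ≤
        (S ∩ Set.Ioo (-((n : ℝ) + 2)) (n + 2)).ncard := by
      rw [← Finset.card_map (Function.Embedding.subtype _), ← Set.ncard_coe_finset]
      refine Nat.cast_le.2 (Set.ncard_le_ncard ?_ (hfin _))
      intro s hs
      simp only [Finset.coe_map, Set.mem_image, Finset.mem_coe, Finset.mem_filter] at hs
      obtain ⟨t, ⟨-, ht⟩, rfl⟩ := hs
      refine ⟨t.2, abs_lt.1 ?_⟩
      have := Nat.lt_floor_add_one |(t : ℝ)|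
      simp only [k] at ht
      rw [ht] at this
      simp only [Function.Embedding.subtype_apply]
      linarith
    refine h1.trans ((hC (n + 2) (by linarith [(Nat.cast_nonneg n : (0 : ℝ) ≤ n)])).trans ?_)
    rw [mul_assoc, ← mul_pow]
    have hn : (0 : ℝ) ≤ n := Nat.cast_nonneg n
    refine (mul_le_mul_of_nonneg_right (le_abs_self C) (by positivity)).trans ?_
    gcongr
    linarith
  calc ∑ s ∈ u with k s = n, ((1 + |(s : ℝ)|) ^ (m + 2))⁻¹
      ≤ ∑ s ∈ u with k s = n, (((n : ℝ) + 1) ^ (m + 2))⁻¹ := by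
        refine Finset.sum_le_sum fun s hs => ?_
        have := Nat.floor_le (abs_nonneg (s : ℝ))
        have h2 : k s = n := (Finset.mem_filter.1 hs).2
        simp only [k] at h2
        rw [h2] at this
        exact inv_anti₀ (by positivity) (pow_le_pow_left₀ (by positivity) (by linarith) _)
    _ = ((u.filter fun s => k s = n).card : ℝ) * (((n : ℝ) + 1) ^ (m + 2))⁻¹ := by
        rw [Finset.sum_const, nsmul_eq_mul]
    _ ≤ |C| * 2 ^ m * ((n : ℝ) + 1) ^ m * (((n : ℝ) + 1) ^ (m + 2))⁻¹ := by gcongr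
    _ = |C| * 2 ^ m * (((n : ℝ) + 1) ^ 2)⁻¹ := by
        have : ((n : ℝ) + 1) ≠ 0 := by positivity
        field_simp
        ring

/-! ### The residue theorem on a rectangle with simple poles on the real axis -/

open Complex in
/-- The integral of `g` along the boundary of the rectangle `[a, b] × [-R, R]`. -/
noncomputable def rectIntegral (g : ℂ → ℂ) (a b R : ℝ) : ℂ :=
  (∫ x in a..b, g (x + ((-R : ℝ) : ℂ) * I)) - (∫ x in a..b, g (x + R * I)) +
    I • (∫ y in (-R)..R, g (b + y * I)) - I • ∫ y in (-R)..R, g (a + y * I)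

/-- The boundary of the rectangle `[a, b] × [-R, R]`. -/
def rectBoundary (a b R : ℝ) : Set ℂ :=
  {z | (z.re ∈ Set.uIcc a b ∧ (z.im = R ∨ z.im = -R)) ∨
    (z.im ∈ Set.uIcc (-R) R ∧ (z.re = a ∨ z.re = b))}

section rect

variable {g h : ℂ → ℂ} {a b R : ℝ}

lemma rectIntegral_congr (hgh : ∀ z ∈ rectBoundary a b R, g z = h z) :
    rectIntegral g a b R = rectIntegral h a b R := by
  unfold rectIntegral
  refine congr_arg₂ _ (congr_arg₂ _ (congr_arg₂ _ ?_ ?_) (congr_arg _ ?_)) (congr_arg _ ?_)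
  all_goals
    refine intervalIntegral.integral_congr fun x hx => hgh _ ?_
    simp [rectBoundary, hx]

lemma intervalIntegrable_of_rectBoundary (hg : ∀ z ∈ rectBoundary a b R, ContinuousAt g z) :
    IntervalIntegrable (fun x : ℝ => g (x + ((-R : ℝ) : ℂ) * Complex.I)) MeasureTheory.volume a b ∧
    IntervalIntegrable (fun x : ℝ => g (x + R * Complex.I)) MeasureTheory.volume a b ∧
    IntervalIntegrable (fun y : ℝ => g (b + y * Complex.I)) MeasureTheory.volume (-R) R ∧
    IntervalIntegrable (fun y : ℝ => g (a + y * Complex.I)) MeasureTheory.volume (-R) R := by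
  refine ⟨?_, ?_, ?_, ?_⟩
  all_goals
    refine ContinuousOn.intervalIntegrable fun x hx => ContinuousAt.continuousWithinAt ?_
    refine ContinuousAt.comp (g := g) (hg _ ?_) (by fun_prop)
    simp [rectBoundary, hx]

lemma rectIntegral_add (hg : ∀ z ∈ rectBoundary a b R, ContinuousAt g z)
    (hh : ∀ z ∈ rectBoundary a b R, ContinuousAt h z) :
    rectIntegral (fun z => g z + h z) a b R = rectIntegral g a b R + rectIntegral h a b R := by
  obtain ⟨g1, g2, g3, g4⟩ := intervalIntegrable_of_rectBoundary hg
  obtain ⟨h1, h2, h3, h4⟩ := intervalIntegrable_of_rectBoundary hh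
  unfold rectIntegral
  rw [intervalIntegral.integral_add g1 h1, intervalIntegral.integral_add g2 h2,
    intervalIntegral.integral_add g3 h3, intervalIntegral.integral_add g4 h4]
  simp only [smul_eq_mul]
  ring

lemma rectIntegral_const_mul (c : ℂ) :
    rectIntegral (fun z => c * g z) a b R = c * rectIntegral g a b R := by
  simp only [rectIntegral, intervalIntegral.integral_const_mul, smul_eq_mul]
  ring

lemma rectIntegral_sum {ι : Type*} (s : Finset ι) (f : ι → ℂ → ℂ)
    (hf : ∀ i ∈ s, ∀ z ∈ rectBoundary a b R, ContinuousAt (f i) z) :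
    rectIntegral (fun z => ∑ i ∈ s, f i z) a b R = ∑ i ∈ s, rectIntegral (f i) a b R := by
  classical
  induction s using Finset.induction_on with
  | empty => simp [rectIntegral]
  | insert i s hi ih =>
    simp only [Finset.sum_insert hi]
    rw [rectIntegral_add (hf i (Finset.mem_insert_self _ _)), ih]
    · exact fun j hj => hf j (Finset.mem_insert_of_mem hj)
    · intro z hz
      exact tendsto_finsetSum s fun j hj => hf j (Finset.mem_insert_of_mem hj) z hz

end rect

lemma integral_div_affine {u v : ℂ} {a b : ℝ} (h : ∀ t : ℝ, u * t + v ∈ Complex.slitPlane) :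
    ∫ t in a..b, u * (u * t + v)⁻¹ = Complex.log (u * b + v) - Complex.log (u * a + v) := by
  have hd : ∀ t : ℝ, HasDerivAt (fun t : ℝ => Complex.log (u * t + v)) (u * (u * t + v)⁻¹) t := by
    intro t
    have h1 : HasDerivAt (fun t : ℝ => u * (t : ℂ) + v) (u * 1) t :=
      ((Complex.ofRealCLM.hasDerivAt (x := t)).const_mul u).add_const v
    rw [mul_one] at h1
    have := h1.clog_real (h t)
    rwa [div_eq_mul_inv] at this
  refine intervalIntegral.integral_eq_sub_of_hasDerivAt (fun t _ => hd t) ?_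
  refine Continuous.intervalIntegrable ?_ _ _
  exact continuous_const.mul (Continuous.inv₀ (by fun_prop)
    fun t => Complex.slitPlane_ne_zero (h t))

lemma log_neg_of_im_pos {w : ℂ} (hw : 0 < w.im) :
    Complex.log (-w) = Complex.log w - Real.pi * Complex.I := by
  rw [Complex.log, Complex.log, Complex.arg_neg_eq_arg_sub_pi_of_im_pos hw, norm_neg]
  push_cast; ring

-- The principal logarithm is a primitive along the bottom, right and top sides. The left side
-- crosses its cut, so log(-w) is used there; the mismatch is πi at each of the two left corners.
open Complex in
lemma rectIntegral_inv {a b R x : ℝ} (hax : a < x) (hxb : x < b) (hR : 0 < R) :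
    rectIntegral (fun z => (z - x)⁻¹) a b R = 2 * Real.pi * I := by
  have hlow := integral_div_affine (u := 1) (v := -R * I - x) (a := a) (b := b)
    (fun t => Or.inr (by simpa using hR.ne'))
  have hup := integral_div_affine (u := 1) (v := R * I - x) (a := a) (b := b)
    (fun t => Or.inr (by simpa using hR.ne'))
  have hright := integral_div_affine (u := I) (v := b - x) (a := -R) (b := R)
    (fun t => Or.inl (by simpa using hxb))
  have hleft := integral_div_affine (u := -I) (v := x - a) (a := -R) (b := R)
    (fun t => Or.inl (by simpa using hax))
  have e1 : rectIntegral (fun z => (z - x)⁻¹) a b R =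
      (∫ t : ℝ in a..b, 1 * (1 * (t : ℂ) + (-R * I - x))⁻¹) -
      (∫ t : ℝ in a..b, 1 * (1 * (t : ℂ) + (R * I - x))⁻¹) +
      (∫ t : ℝ in (-R)..R, I * (I * (t : ℂ) + (b - x))⁻¹) -
      (∫ t : ℝ in (-R)..R, -I * (-I * (t : ℂ) + (x - a))⁻¹) := by
    unfold rectIntegral
    rw [← intervalIntegral.integral_smul, ← intervalIntegral.integral_smul]
    refine congr_arg₂ _ (congr_arg₂ _ (congr_arg₂ _ ?_ ?_) ?_) ?_
    all_goals refine intervalIntegral.integral_congr fun t _ => ?_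
    · simp only [one_mul]; congr 1; push_cast; ring
    · simp only [one_mul]; congr 1; ring
    · simp only [smul_eq_mul]; congr 2; ring
    · simp only [smul_eq_mul]
      rw [show -I * (t : ℂ) + (x - a) = -(a + t * I - x) by ring, inv_neg]; ring
  rw [e1, hlow, hup, hright, hleft]
  have l1 := log_neg_of_im_pos (w := a + R * I - x) (by simpa using hR)
  have l2 := log_neg_of_im_pos (w := -(a - R * I - x)) (by simpa using hR)
  rw [neg_neg] at l2
  rw [show -I * (R : ℂ) + (x - a) = -(a + R * I - x) by ring, l1,
    show -I * ((-R : ℝ) : ℂ) + (x - a) = -(a - R * I - x) by push_cast; ring,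
    show (1 : ℂ) * a + (-R * I - x) = a - R * I - x by ring, l2,
    show (1 : ℂ) * b + (-R * I - x) = I * ((-R : ℝ) : ℂ) + (b - x) by push_cast; ring,
    show (1 : ℂ) * b + (R * I - x) = I * R + (b - x) by ring,
    show (1 : ℂ) * a + (R * I - x) = a + R * I - x by ring]
  ring

-- Subtracting the principal parts leaves removable singularities, so Cauchy's theorem disposes of
-- the remainder and only integrals of 1/(z - x) survive.
open Complex in
theorem rectIntegral_eq_sum_residues {g : ℂ → ℂ} {a b R : ℝ} (L : Finset ℝ) (c : ℝ → ℂ)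
    (hR : 0 < R) (hL : ∀ x ∈ L, a < x ∧ x < b)
    (hd : ∀ z : ℂ, z ∈ Set.uIcc a b ×ℂ Set.uIcc (-R) R → (∀ x ∈ L, z ≠ (x : ℂ)) →
      DifferentiableAt ℂ g z)
    (hres : ∀ x ∈ L, ∃ v, Filter.Tendsto (fun z => g z - c x * (z - x)⁻¹)
      (nhdsWithin (x : ℂ) {(x : ℂ)}ᶜ) (nhds v)) :
    rectIntegral g a b R = 2 * Real.pi * I * ∑ x ∈ L, c x := by
  classical
  set L' : Set ℂ := ofReal '' (L : Set ℝ) with hL'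
  have hfin : L'.Finite := L.finite_toSet.image _
  have hnot : ∀ z, z ∉ L' ↔ ∀ x ∈ L, z ≠ (x : ℂ) := by
    intro z
    simp only [hL', Set.mem_image, Finset.mem_coe, not_exists, not_and]
    exact forall₂_congr fun x _ => ne_comm
  have hdiff : ∀ x : ℝ, ∀ z : ℂ, z ≠ x → DifferentiableAt ℂ (fun w : ℂ => c x * (w - x)⁻¹) z :=
    fun x z hz => (differentiableAt_const _).mul
      ((differentiableAt_id.sub_const _).inv (sub_ne_zero.2 hz))
  set h : ℂ → ℂ := fun z => g z - ∑ x ∈ L, c x * (z - x)⁻¹ with hh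
  -- `h` with its removable singularities filled in by their limits; Cauchy's theorem asks for
  -- continuity on the rectangle and differentiability off a countable set.
  set H : ℂ → ℂ := fun z => if z ∈ L' then Filter.limUnder (nhdsWithin z {z}ᶜ) h else h z with hH
  have hHh : ∀ z, z ∉ L' → H z = h z := fun z hz => by simp only [hH, if_neg hz]
  have hdh : ∀ z : ℂ, z ∈ Set.uIcc a b ×ℂ Set.uIcc (-R) R → z ∉ L' →
      DifferentiableAt ℂ H z := by
    intro z hz hzL
    have h1 : DifferentiableAt ℂ h z := (hd z hz ((hnot z).1 hzL)).sub
      (DifferentiableAt.fun_sum fun x hx => hdiff x z ((hnot z).1 hzL x hx))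
    refine h1.congr_of_eventuallyEq ?_
    filter_upwards [hfin.isClosed.isOpen_compl.mem_nhds hzL] with w hw using hHh w hw
  have hcont : ContinuousOn H (Set.uIcc a b ×ℂ Set.uIcc (-R) R) := by
    intro z hz
    by_cases hzL : z ∈ L'
    · obtain ⟨x, hx, rfl⟩ := hzL
      have hx' : x ∈ L := hx
      obtain ⟨v, hv⟩ := hres x hx'
      have hlim : Filter.Tendsto h (nhdsWithin (x : ℂ) {(x : ℂ)}ᶜ)
          (nhds (v - ∑ y ∈ L.erase x, c y * ((x : ℂ) - y)⁻¹)) := by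
        have h2 : ContinuousAt (fun w : ℂ => ∑ y ∈ L.erase x, c y * (w - y)⁻¹) (x : ℂ) :=
          tendsto_finsetSum _ fun y hy => (hdiff y x (by
            have := (Finset.ne_of_mem_erase hy).symm
            exact_mod_cast this)).continuousAt
        have h3 := hv.sub (h2.tendsto.mono_left nhdsWithin_le_nhds)
        refine h3.congr fun w => ?_
        simp only [hh]
        rw [← Finset.add_sum_erase L _ hx']
        ring
      refine ContinuousAt.continuousWithinAt (continuousAt_iff_punctured_nhds.2 ?_)
      have hval : H x = v - ∑ y ∈ L.erase x, c y * ((x : ℂ) - y)⁻¹ := by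
        simp only [hH, if_pos (show (x : ℂ) ∈ L' from ⟨x, hx, rfl⟩)]
        exact hlim.limUnder_eq
      rw [hval]
      refine hlim.congr' ?_
      have : ∀ᶠ w in nhdsWithin (x : ℂ) {(x : ℂ)}ᶜ, w ∉ L' := by
        have h4 := (hfin.subset (Set.sdiff_subset (t := {(x : ℂ)}))).isClosed.isOpen_compl.mem_nhds
          (show (x : ℂ) ∈ (L' \ {(x : ℂ)})ᶜ by simp)
        filter_upwards [mem_nhdsWithin_of_mem_nhds h4, self_mem_nhdsWithin] with w hw hw' hwL
        exact hw ⟨hwL, hw'⟩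
      filter_upwards [this] with w hw using (hHh w hw).symm
    · exact (hdh z hz hzL).continuousAt.continuousWithinAt
  have hzero : rectIntegral H a b R = 0 := by
    have := integral_boundary_rect_eq_zero_of_differentiable_on_off_countable H
      (a + ((-R : ℝ) : ℂ) * I) (b + R * I) L' hfin.countable (by simpa using hcont) ?_
    · simpa [rectIntegral] using this
    · rintro z ⟨hz, hzL⟩
      refine hdh z ?_ hzL
      simp only [Complex.mem_reProdIm, add_re, ofReal_re, mul_re, I_re, mul_zero, ofReal_im, I_im,
        mul_one, sub_self, add_zero, add_im, mul_im, zero_add] at hz ⊢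
      exact ⟨Set.Ioo_subset_Icc_self hz.1, Set.Ioo_subset_Icc_self hz.2⟩
  have hbd : ∀ z ∈ rectBoundary a b R, z ∈ Set.uIcc a b ×ℂ Set.uIcc (-R) R ∧ z ∉ L' := by
    intro z hz
    have hR' : -R ≤ R := by linarith
    constructor
    · rw [Complex.mem_reProdIm]
      rcases hz with ⟨h1, h2 | h2⟩ | ⟨h1, h2 | h2⟩
      · exact ⟨h1, by rw [h2]; exact Set.right_mem_uIcc⟩
      · exact ⟨h1, by rw [h2]; exact Set.left_mem_uIcc⟩
      · exact ⟨by rw [h2]; exact Set.left_mem_uIcc, h1⟩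
      · exact ⟨by rw [h2]; exact Set.right_mem_uIcc, h1⟩
    · rintro ⟨x, hx, rfl⟩
      obtain ⟨h1, h2⟩ := hL x hx
      rcases hz with ⟨-, h3 | h3⟩ | ⟨-, h3 | h3⟩ <;> simp at h3 <;> linarith
  rw [rectIntegral_congr (h := fun z => H z + ∑ x ∈ L, c x * (z - x)⁻¹)
    (fun z hz => by rw [hHh z (hbd z hz).2]; simp [hh]),
    rectIntegral_add (fun z hz => (hdh z (hbd z hz).1 (hbd z hz).2).continuousAt)
    (fun z hz => tendsto_finsetSum _ fun x hx =>
      (hdiff x z ((hnot z).1 (hbd z hz).2 x hx)).continuousAt),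
    hzero, zero_add, rectIntegral_sum L _ (fun x hx z hz =>
      (hdiff x z ((hnot z).1 (hbd z hz).2 x hx)).continuousAt), Finset.mul_sum]
  refine Finset.sum_congr rfl fun x hx => ?_
  rw [rectIntegral_const_mul, rectIntegral_inv (hL x hx).1 (hL x hx).2 hR, mul_comm]

/-! ### Fourier–Laplace transforms of compactly supported functions -/

/-- The Fourier–Laplace transform `z ↦ ∫ h(t) e^{2π i t z} dt`. -/
noncomputable def expTransform (h : ℝ → ℂ) (z : ℂ) : ℂ := ∫ t, h t * wave t z

@[fun_prop] lemma continuous_wave_freq (z : ℂ) : Continuous (fun t : ℝ => wave t z) := by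
  unfold wave; fun_prop

lemma integrable_mul_of_hasCompactSupport {h g : ℝ → ℂ} (hh : Continuous h)
    (hc : HasCompactSupport h) (hg : Continuous g) :
    MeasureTheory.Integrable (fun t => h t * g t) :=
  (hh.mul hg).integrable_of_hasCompactSupport hc.mul_right

lemma differentiable_expTransform {h : ℝ → ℂ} (hh : Continuous h) (hc : HasCompactSupport h) :
    Differentiable ℂ (expTransform h) := by
  intro z
  have hb : ∀ t : ℝ, ∀ w ∈ Metric.ball z 1,
      ‖h t * (wave t w * (2 * Real.pi * Complex.I * t))‖ ≤
        ‖h t‖ * (Real.exp (2 * Real.pi * |t| * (|z.im| + 1)) * (2 * Real.pi * |t|)) := by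
    intro t w hw
    rw [norm_mul, norm_mul, norm_wave]
    have h1 : |w.im| ≤ |z.im| + 1 := by
      have h2 : |(w - z).im| ≤ ‖w - z‖ := Complex.abs_im_le_norm _
      have h3 : ‖w - z‖ < 1 := by rwa [← dist_eq_norm]
      have h4 := abs_sub_abs_le_abs_sub w.im z.im
      rw [Complex.sub_im] at h2
      linarith
    have h5 : -(t * w.im) ≤ |t| * (|z.im| + 1) := by
      refine (neg_le_abs _).trans ?_
      rw [abs_mul]; gcongr
    have h6 : ‖(2 * Real.pi * Complex.I * t : ℂ)‖ = 2 * Real.pi * |t| := by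
      simp [abs_of_pos Real.pi_pos]
    rw [h6]
    gcongr
    nlinarith [Real.pi_pos]
  refine (hasDerivAt_integral_of_dominated_loc_of_deriv_le (Metric.ball_mem_nhds z one_pos)
    (F := fun w t => h t * wave t w)
    (F' := fun w t => h t * (wave t w * (2 * Real.pi * Complex.I * t)))
    (Filter.Eventually.of_forall fun w =>
      (integrable_mul_of_hasCompactSupport hh hc (by fun_prop)).aestronglyMeasurable)
    (integrable_mul_of_hasCompactSupport hh hc (by fun_prop))
    (integrable_mul_of_hasCompactSupport hh hc (by fun_prop)).aestronglyMeasurable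
    (Filter.Eventually.of_forall hb) ?_
    (Filter.Eventually.of_forall fun t w _ => ?_)).2.differentiableAt
  · refine Continuous.integrable_of_hasCompactSupport (by fun_prop) hc.norm.mul_right
  · refine HasDerivAt.const_mul (h t) ?_
    have := ((hasDerivAt_id w).const_mul (2 * Real.pi * Complex.I * t)).cexp
    rw [mul_one] at this
    exact this

/-- The weighted `L¹` norm controlling the Fourier–Laplace transform on a strip. -/
noncomputable def expNorm (R : ℝ) (h : ℝ → ℂ) : ℝ := ∫ t, ‖h t‖ * Real.exp (2 * Real.pi * |t| * R)

lemma expNorm_nonneg (R : ℝ) (h : ℝ → ℂ) : 0 ≤ expNorm R h :=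
  MeasureTheory.integral_nonneg fun t => by positivity

lemma norm_expTransform_le {h : ℝ → ℂ} (hh : Continuous h) (hc : HasCompactSupport h) {R : ℝ}
    {z : ℂ} (hz : |z.im| ≤ R) : ‖expTransform h z‖ ≤ expNorm R h := by
  refine MeasureTheory.norm_integral_le_of_norm_le
    (Continuous.integrable_of_hasCompactSupport (by fun_prop) hc.norm.mul_right)
    (Filter.Eventually.of_forall fun t => ?_)
  rw [norm_mul, norm_wave]
  have h5 : -(t * z.im) ≤ |t| * R := by
    refine (neg_le_abs _).trans ?_
    rw [abs_mul]; gcongr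
  gcongr
  nlinarith [Real.pi_pos]

/-- Integration by parts; applied twice it trades two derivatives of h for quadratic decay. -/
lemma expTransform_deriv {h : ℝ → ℂ} (hh : ContDiff ℝ 1 h) (hc : HasCompactSupport h) (z : ℂ) :
    expTransform (deriv h) z = -(2 * Real.pi * Complex.I * z) * expTransform h z := by
  have hd : ∀ t : ℝ, HasDerivAt (fun t : ℝ => wave t z) (2 * Real.pi * Complex.I * z * wave t z)
      t := by
    intro t
    have := ((Complex.ofRealCLM.hasDerivAt (x := t)).const_mul (2 * Real.pi * Complex.I)).mul_const z
    have := this.cexp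
    simp only [Complex.ofRealCLM_apply, Complex.ofReal_one, mul_one] at this
    exact this.congr_deriv (mul_comm _ _)
  have hcont := hh.continuous
  have hcont' : Continuous (deriv h) := hh.continuous_deriv le_rfl
  have := MeasureTheory.integral_mul_deriv_eq_deriv_mul_of_integrable (u := h)
    (v := fun t => wave t z) (u' := deriv h) (v' := fun t => 2 * Real.pi * Complex.I * z * wave t z)
    (fun t _ => (hh.differentiable one_ne_zero t).hasDerivAt) (fun t _ => hd t)
    (integrable_mul_of_hasCompactSupport hcont hc (by fun_prop))
    (integrable_mul_of_hasCompactSupport hcont' hc.deriv (by fun_prop))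
    (integrable_mul_of_hasCompactSupport hcont hc (by fun_prop))
  rw [expTransform, expTransform, ← neg_eq_iff_eq_neg.2 this, neg_mul,
    ← MeasureTheory.integral_const_mul]
  congr 2
  ext t
  ring

/-- Quadratic decay of the Fourier–Laplace transform on strips. -/
theorem one_add_sq_mul_norm_expTransform_le {h : ℝ → ℂ} (hh : ContDiff ℝ 2 h)
    (hc : HasCompactSupport h) {R : ℝ} {z : ℂ} (hz : |z.im| ≤ R) :
    (1 + ‖z‖ ^ 2) * ‖expTransform h z‖ ≤ expNorm R h + expNorm R (deriv (deriv h)) := by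
  have hh' : ContDiff ℝ 1 (deriv h) := hh.deriv'
  have h1 : expTransform (deriv (deriv h)) z =
      -(2 * Real.pi * Complex.I * z) * (-(2 * Real.pi * Complex.I * z) * expTransform h z) := by
    rw [expTransform_deriv hh' hc.deriv, expTransform_deriv (hh.of_le one_le_two) hc]
  have h2 := norm_expTransform_le (hh'.continuous_deriv le_rfl) hc.deriv.deriv hz
  have h3 := norm_expTransform_le hh.continuous hc hz
  rw [h1] at h2
  simp only [norm_mul, norm_neg, Complex.norm_I, Complex.norm_real, Complex.norm_ofNat,
    Real.norm_eq_abs, abs_of_pos Real.pi_pos, mul_one] at h2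
  have h4 : (1 : ℝ) ≤ (2 * Real.pi) ^ 2 := by nlinarith [Real.pi_gt_three]
  have h5 : ‖z‖ ^ 2 * ‖expTransform h z‖ ≤
      2 * Real.pi * ‖z‖ * (2 * Real.pi * ‖z‖ * ‖expTransform h z‖) := by
    nlinarith [mul_le_mul_of_nonneg_right h4 (by positivity : 0 ≤ ‖z‖ ^ 2 * ‖expTransform h z‖)]
  linarith

lemma expTransform_ofReal (h : ℝ → ℂ) (x : ℝ) : expTransform h x = 𝓕⁻ h x := by
  rw [Real.fourierInv_eq', expTransform]
  congr 1
  ext t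
  rw [wave, smul_eq_mul, mul_comm]
  congr 2
  simp
  ring

lemma integrable_of_one_add_sq_bound {f : ℝ → ℂ} (hf : Continuous f) {C : ℝ}
    (hC : ∀ x, (1 + x ^ 2) * ‖f x‖ ≤ C) : MeasureTheory.Integrable f := by
  refine (integrable_inv_one_add_sq.const_mul C).mono' hf.aestronglyMeasurable
    (Filter.Eventually.of_forall fun x => ?_)
  rw [← div_eq_mul_inv, le_div_iff₀ (by positivity), mul_comm]
  exact hC x

lemma one_add_sq_le (x y : ℝ) : 1 + x ^ 2 ≤ 1 + ‖(x + y * Complex.I : ℂ)‖ ^ 2 := by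
  have := Complex.abs_re_le_norm (x + y * Complex.I : ℂ)
  simp only [Complex.add_re, Complex.ofReal_re, Complex.mul_re, Complex.I_re, mul_zero,
    Complex.ofReal_im, Complex.I_im, mul_one, sub_self, add_zero] at this
  have h2 := pow_le_pow_left₀ (abs_nonneg _) this 2
  rw [sq_abs] at h2
  linarith

/-- Fourier inversion along a horizontal line. -/
theorem integrable_and_integral_expTransform_mul_wave {h : ℝ → ℂ} (hh : ContDiff ℝ 2 h)
    (hc : HasCompactSupport h) (s y : ℝ) :
    MeasureTheory.Integrable (fun x : ℝ => expTransform h (x + y * Complex.I) *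
      wave s (x + y * Complex.I)) ∧
    ∫ x : ℝ, expTransform h (x + y * Complex.I) * wave s (x + y * Complex.I) = h (-s) := by
  -- Multiplying by `wave s` translates h, and the height y becomes a real exponential weight;
  -- inversion at 0 then reads off k(0) = h(-s).
  set k : ℝ → ℂ := fun t => h (t - s) * wave t (y * Complex.I) with hk
  have hkc : Continuous k := by
    have := hh.continuous
    fun_prop
  have hks : HasCompactSupport k := by
    have : HasCompactSupport (fun t => h (t - s)) := by
      exact hc.comp_homeomorph (Homeomorph.subRight s)
    exact this.mul_right
  have hT : ∀ x : ℝ, expTransform h (x + y * Complex.I) * wave s (x + y * Complex.I) =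
      𝓕⁻ k x := by
    intro x
    rw [← expTransform_ofReal, expTransform, expTransform, ← MeasureTheory.integral_mul_const,
      ← MeasureTheory.integral_sub_right_eq_self _ s]
    congr 1
    ext t
    simp only [hk]
    rw [mul_assoc, ← wave_add_freq, sub_add_cancel, wave_add_arg]
    ring
  have hcont : Continuous (fun x : ℝ => expTransform h (x + y * Complex.I) *
      wave s (x + y * Complex.I)) := by
    have := (differentiable_expTransform hh.continuous hc).continuous
    fun_prop
  have hint : MeasureTheory.Integrable (fun x : ℝ => expTransform h (x + y * Complex.I) *
      wave s (x + y * Complex.I)) := by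
    refine integrable_of_one_add_sq_bound hcont (C := (expNorm |y| h +
      expNorm |y| (deriv (deriv h))) * Real.exp (-(2 * Real.pi * s * y))) fun x => ?_
    have h1 := one_add_sq_mul_norm_expTransform_le hh hc (R := |y|) (z := x + y * Complex.I)
      (by simp)
    rw [norm_mul, norm_wave, ← mul_assoc]
    simp only [Complex.add_im, Complex.ofReal_im, Complex.mul_im, Complex.ofReal_re, Complex.I_im,
      mul_one, Complex.I_re, mul_zero, add_zero, zero_add]
    gcongr
    exact (mul_le_mul_of_nonneg_right (one_add_sq_le x y) (norm_nonneg _)).trans h1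
  refine ⟨hint, ?_⟩
  simp only [hT] at hint ⊢
  have hint' : MeasureTheory.Integrable (𝓕 k) := by
    have := hint.comp_neg
    simpa [Real.fourierInv_eq_fourier_neg] using this
  have hinv := congrFun (hkc.fourier_fourierInv_eq (hkc.integrable_of_hasCompactSupport hks) hint') 0
  rw [Real.fourier_eq'] at hinv
  simpa [hk, wave] using hinv

/-- Termwise integration of an absolutely convergent expansion along a horizontal line. -/
theorem hasSum_integral_expansion {h : ℝ → ℂ} (hh : ContDiff ℝ 2 h) (hc : HasCompactSupport h)
    {ι : Type*} [Countable ι] (p : ι → ℂ) (ν : ι → ℝ) (y : ℝ) {F : ℂ → ℂ}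
    (hF : ∀ x : ℝ, HasSum (fun i => p i * wave (ν i) (x + y * Complex.I))
      (F (x + y * Complex.I))) :
    HasSum (fun i => p i * h (-ν i))
      (∫ x : ℝ, F (x + y * Complex.I) * expTransform h (x + y * Complex.I)) := by
  -- |wave| is constant along a horizontal line, so absolute convergence at x = 0 controls the whole
  -- line.
  have hsplit : ∀ (i : ι) (x : ℝ), ‖p i * (expTransform h (x + y * Complex.I) *
      wave (ν i) (x + y * Complex.I))‖ =
      ‖p i * wave (ν i) ((0 : ℝ) + y * Complex.I)‖ * ‖expTransform h (x + y * Complex.I)‖ := by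
    intro i x
    simp only [norm_mul, norm_wave]
    simp
    ring
  have hint := fun i => (integrable_and_integral_expTransform_mul_wave hh hc (ν i) y)
  have hsum := MeasureTheory.hasSum_integral_of_summable_integral_norm
    (F := fun i (x : ℝ) => p i * (expTransform h (x + y * Complex.I) *
      wave (ν i) (x + y * Complex.I))) (fun i => (hint i).1.const_mul (p i)) (by
      simp only [hsplit, MeasureTheory.integral_const_mul]
      exact (hF 0).summable.norm.mul_right _)
  have h1 : (fun i => p i * h (-ν i)) = fun i => ∫ x : ℝ, p i *
      (expTransform h (x + y * Complex.I) * wave (ν i) (x + y * Complex.I)) := by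
    ext i
    rw [MeasureTheory.integral_const_mul, (hint i).2]
  have h2 : ∀ x : ℝ, F (x + y * Complex.I) * expTransform h (x + y * Complex.I) =
      ∑' i, p i * (expTransform h (x + y * Complex.I) * wave (ν i) (x + y * Complex.I)) := by
    intro x
    rw [← ((hF x).mul_right (expTransform h (x + y * Complex.I))).tsum_eq]
    congr 1
    ext i
    ring
  simp only [h1, h2]
  exact hsum

/-! ### The contour formula -/

/-- If x is within δ/4 of some t ∈ Λ, then t + δ/4 works: every other point is at least 3δ/4 from
it. This places the vertical sides of the contours. -/
lemma IsUniformlyDiscrete.exists_gap {Λ : Set ℝ} {δ : ℝ} (hδ : 0 < δ)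
    (hsep : ∀ x ∈ Λ, ∀ y ∈ Λ, x ≠ y → δ ≤ dist x y) (x : ℝ) :
    ∃ y, x ≤ y ∧ y ≤ x + δ ∧ ∀ t ∈ Λ, δ / 4 ≤ |y - t| := by
  by_cases h : ∀ t ∈ Λ, δ / 4 ≤ |x - t|
  · exact ⟨x, le_rfl, by linarith, h⟩
  · push Not at h
    obtain ⟨t, ht, h1⟩ := h
    rw [abs_lt] at h1
    refine ⟨t + δ / 4, by linarith, by linarith, fun u hu => ?_⟩
    rcases eq_or_ne t u with rfl | hne
    · rw [add_sub_cancel_left, abs_of_pos (by positivity)]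
    · have h2 := hsep t ht u hu hne
      rw [Real.dist_eq] at h2
      have h3 : |t - u| ≤ |t + δ / 4 - u| + |δ / 4| := by
        have := abs_sub_abs_le_abs_sub (t - u) (-(δ / 4))
        rw [abs_neg, sub_neg_eq_add] at this
        rw [show t + δ / 4 - u = t - u + δ / 4 by ring]
        linarith
      rw [abs_of_pos (show 0 < δ / 4 by positivity)] at h3
      linarith

/-- With K = E / `dslope φ a`, the difference is the difference quotient of K at a, so it tends to
K'(a). -/
lemma exists_tendsto_sub_principal_part {φ E : ℂ → ℂ} (hφ : Differentiable ℂ φ)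
    (hE : Differentiable ℂ E) {a : ℂ} (ha : φ a = 0) (ha' : deriv φ a ≠ 0) :
    ∃ v, Filter.Tendsto (fun z => E z / φ z - E a / deriv φ a * (z - a)⁻¹)
      (nhdsWithin a {a}ᶜ) (nhds v) := by
  have hds : Differentiable ℂ (dslope φ a) := by
    rw [← differentiableOn_univ] at hφ ⊢
    exact (Complex.differentiableOn_dslope Filter.univ_mem).2 hφ
  have hda : dslope φ a a ≠ 0 := by simpa using ha'
  have hK : DifferentiableAt ℂ (fun z => E z / dslope φ a z) a := (hE a).div (hds a) hda
  refine ⟨_, (hasDerivAt_iff_tendsto_slope.1 hK.hasDerivAt).congr' ?_⟩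
  filter_upwards [self_mem_nhdsWithin,
    mem_nhdsWithin_of_mem_nhds (hds.continuous.continuousAt.eventually_ne hda)] with z hz hz'
  have hz : z ≠ a := hz
  have hfac := sub_smul_dslope φ a z
  simp only [smul_eq_mul, ha, sub_zero] at hfac
  have : z - a ≠ 0 := sub_ne_zero.2 hz
  rw [slope_def_field, dslope_same, ← hfac]
  field_simp

open Complex in
/-- The residue theorem for `ψ f / φ` on a horizontal strip. -/
theorem hasSum_residues_strip {φ ψ f : ℂ → ℂ} (hφ : Differentiable ℂ φ) (hψ : Differentiable ℂ ψ)
    (hf : Differentiable ℂ f) (hreal : ∀ z ∈ zeroSet φ, z.im = 0)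
    (hsimple : ∀ z ∈ zeroSet φ, deriv φ z ≠ 0) {δ : ℝ} (hδ : 0 < δ)
    (hsep : ∀ x ∈ realZeroSet φ, ∀ y ∈ realZeroSet φ, x ≠ y → δ ≤ dist x y)
    {R M C : ℝ} (hR : 0 < R) (hM0 : 0 ≤ M) (hC0 : 0 ≤ C)
    (hM : ∀ z : ℂ, |z.im| ≤ R → (∀ w, φ w = 0 → min R (δ / 4) ≤ dist z w) → ‖ψ z / φ z‖ ≤ M)
    (hC : ∀ z : ℂ, |z.im| ≤ R → (1 + ‖z‖ ^ 2) * ‖f z‖ ≤ C)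
    (hsum : Summable (fun x : realZeroSet φ => massCoeff φ ψ x * f x)) :
    HasSum (fun x : realZeroSet φ => 2 * Real.pi * I * (massCoeff φ ψ x * f x))
      ((∫ x : ℝ, ψ (x + ((-R : ℝ) : ℂ) * I) / φ (x + ((-R : ℝ) : ℂ) * I) *
          f (x + ((-R : ℝ) : ℂ) * I)) -
        ∫ x : ℝ, ψ (x + R * I) / φ (x + R * I) * f (x + R * I)) := by
  classical
  set Λ := realZeroSet φ
  have hΛ : IsUniformlyDiscrete Λ := ⟨δ, hδ, hsep⟩
  have hlf := hΛ.isLocallyFiniteSet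
  set g : ℂ → ℂ := fun z => ψ z / φ z * f z with hg
  have hzero : ∀ w, φ w = 0 → ∃ t ∈ Λ, w = (t : ℂ) := by
    intro w hw
    have h1 : w = (w.re : ℂ) := by
      apply Complex.ext <;> simp [hreal w hw]
    refine ⟨w.re, ?_, h1⟩
    show φ (w.re : ℂ) = 0
    rw [← h1]; exact hw
  have hgd : ∀ z, φ z ≠ 0 → DifferentiableAt ℂ g z := fun z hz =>
    ((hψ z).div (hφ z) hz).mul (hf z)
  have hgb : ∀ z : ℂ, |z.im| ≤ R → (∀ w, φ w = 0 → min R (δ / 4) ≤ dist z w) →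
      (1 + ‖z‖ ^ 2) * ‖g z‖ ≤ M * C := by
    intro z hz hw
    have h1 := hM z hz hw
    have h2 := hC z hz
    calc (1 + ‖z‖ ^ 2) * ‖g z‖ = ‖ψ z / φ z‖ * ((1 + ‖z‖ ^ 2) * ‖f z‖) := by
          simp only [hg, norm_mul]; ring
      _ ≤ M * C := mul_le_mul h1 h2 (by positivity) hM0
  have hline : ∀ y : ℝ, |y| = R → MeasureTheory.Integrable (fun x : ℝ => g (x + y * I)) := by
    intro y hy
    have hy0 : y ≠ 0 := by rintro rfl; simp at hy; linarith
    refine integrable_of_one_add_sq_bound (C := M * C) ?_ fun x => ?_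
    · refine continuous_iff_continuousAt.2 fun x => ?_
      refine ContinuousAt.comp (g := g) (hgd _ fun h0 => hy0 ?_).continuousAt (by fun_prop)
      simpa using hreal _ h0
    · refine (mul_le_mul_of_nonneg_right (one_add_sq_le x y) (norm_nonneg _)).trans
        (hgb _ (by simp [hy]) fun w hw => (min_le_left _ _).trans ?_)
      obtain ⟨t, -, rfl⟩ := hzero w hw
      rw [dist_eq_norm]
      refine le_trans ?_ (Complex.abs_im_le_norm _)
      simp [hy]
  have hcol : ∀ x : ℝ, (∀ t ∈ Λ, δ / 4 ≤ |x - t|) → ∀ y : ℝ, |y| ≤ R →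
      ‖g (x + y * I)‖ ≤ M * C / (1 + x ^ 2) := by
    intro x hx y hy
    rw [le_div_iff₀ (by positivity), mul_comm]
    refine (mul_le_mul_of_nonneg_right (one_add_sq_le x y) (norm_nonneg _)).trans
      (hgb _ (by simpa using hy) fun w hw => (min_le_right _ _).trans ?_)
    obtain ⟨t, ht, rfl⟩ := hzero w hw
    rw [dist_eq_norm]
    refine (hx t ht).trans (le_trans (le_of_eq ?_) (Complex.abs_re_le_norm _))
    simp
  choose b hb1 hb2 hb using fun n : ℕ => IsUniformlyDiscrete.exists_gap hδ hsep (n : ℝ)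
  -- Starting at -n - δ keeps a n ≤ -n even after the shift by up to δ.
  choose a ha1 ha2 ha using fun n : ℕ => IsUniformlyDiscrete.exists_gap hδ hsep (-(n : ℝ) - δ)
  have hbt : Filter.Tendsto b Filter.atTop Filter.atTop :=
    Filter.tendsto_atTop_mono hb1 tendsto_natCast_atTop_atTop
  have hat : Filter.Tendsto a Filter.atTop Filter.atBot := by
    refine Filter.tendsto_atBot_mono (fun n => (ha2 n).trans (le_of_eq (by ring)))
      (Filter.tendsto_neg_atBot_iff.2 tendsto_natCast_atTop_atTop)
  have hfin : ∀ n, {x : Λ | a n < x ∧ (x : ℝ) < b n}.Finite := by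
    intro n
    refine Set.Finite.of_finite_image (f := Subtype.val)
      ((hlf (max (-a n) (b n))).subset ?_) Subtype.val_injective.injOn
    rintro _ ⟨x, ⟨h1, h2⟩, rfl⟩
    exact ⟨x.2, by linarith [le_max_left (-a n) (b n)], h2.trans_le (le_max_right _ _)⟩
  set u : ℕ → Finset Λ := fun n => (hfin n).toFinset
  have hut : Filter.Tendsto u Filter.atTop Filter.atTop := by
    refine Filter.tendsto_atTop.2 fun s => ?_
    have : ∀ᶠ n in Filter.atTop, ∀ x ∈ s, a n < x ∧ (x : ℝ) < b n :=
      (Finset.eventually_all s).2 fun x _ =>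
        (hat.eventually_lt_atBot _).and (hbt.eventually_gt_atTop _)
    filter_upwards [this] with n hn x hx
    exact (hfin n).mem_toFinset.2 (hn x hx)
  have hrect : ∀ n, rectIntegral g (a n) (b n) R =
      ∑ x ∈ u n, 2 * Real.pi * I * (massCoeff φ ψ x * f x) := by
    intro n
    have h1 := rectIntegral_eq_sum_residues (g := g) (a := a n) (b := b n)
      ((u n).map (Function.Embedding.subtype _)) (fun x => massCoeff φ ψ x * f x) hR ?_ ?_ ?_
    · rw [h1, Finset.sum_map, Finset.mul_sum]; rfl
    · intro x hx
      obtain ⟨t, ht, rfl⟩ := Finset.mem_map.1 hx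
      exact (hfin n).mem_toFinset.1 ht
    · intro z hz hzL
      refine hgd z fun h0 => ?_
      obtain ⟨t, ht, rfl⟩ := hzero z h0
      have hmem : t ∈ Set.uIcc (a n) (b n) := by simpa using hz.1
      have hab : a n ≤ b n := by
        linarith [ha2 n, hb1 n, (Nat.cast_nonneg n : (0 : ℝ) ≤ n)]
      rw [Set.uIcc_of_le hab] at hmem
      have hne1 : a n ≠ t := by
        rintro rfl; have := ha n _ ht; simp at this; linarith
      have hne2 : b n ≠ t := by
        rintro rfl; have := hb n _ ht; simp at this; linarith
      refine hzL t (Finset.mem_map.2 ⟨⟨t, ht⟩, (hfin n).mem_toFinset.2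
        ⟨lt_of_le_of_ne hmem.1 hne1, lt_of_le_of_ne hmem.2 hne2.symm⟩, rfl⟩) rfl
    · intro x hx
      obtain ⟨t, -, rfl⟩ := Finset.mem_map.1 hx
      obtain ⟨v, hv⟩ := exists_tendsto_sub_principal_part hφ (hψ.mul hf) t.2 (hsimple _ t.2)
      refine ⟨v, hv.congr fun z => ?_⟩
      simp only [hg, massCoeff, Pi.mul_apply, Function.Embedding.subtype_apply]
      ring
  have hvert : ∀ c : ℕ → ℝ, (∀ n : ℕ, (n : ℝ) ≤ |c n|) →
      (∀ n, ∀ t ∈ Λ, δ / 4 ≤ |c n - t|) →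
      Filter.Tendsto (fun n => I • ∫ y in (-R)..R, g (c n + y * I)) Filter.atTop (nhds 0) := by
    intro c hc1 hc2
    have h1 : ∀ n : ℕ, ‖I • ∫ y in (-R)..R, g (c n + y * I)‖ ≤
        M * C * (1 + (n : ℝ) ^ 2)⁻¹ * |R - -R| := by
      intro n
      rw [norm_smul, norm_I, one_mul]
      refine intervalIntegral.norm_integral_le_of_norm_le_const fun y hy => ?_
      rw [Set.uIoc_of_le (by linarith)] at hy
      refine (hcol _ (hc2 n) y (abs_le.2 ⟨hy.1.le, hy.2⟩)).trans ?_
      rw [div_eq_mul_inv]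
      have : (n : ℝ) ^ 2 ≤ c n ^ 2 := by
        rw [← sq_abs (c n)]
        exact pow_le_pow_left₀ (Nat.cast_nonneg n) (hc1 n) 2
      gcongr
    refine squeeze_zero_norm h1 ?_
    have h2 : Filter.Tendsto (fun n : ℕ => (1 + (n : ℝ) ^ 2)⁻¹) Filter.atTop (nhds 0) :=
      tendsto_inv_atTop_zero.comp (Filter.tendsto_atTop_add_const_left _ _
        ((Filter.tendsto_pow_atTop two_ne_zero).comp tendsto_natCast_atTop_atTop))
    simpa using (h2.const_mul (M * C)).mul_const |R - -R|
  have hlim := (((MeasureTheory.intervalIntegral_tendsto_integral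
    (hline (-R) (by rw [abs_neg, abs_of_pos hR])) hat hbt).sub
    (MeasureTheory.intervalIntegral_tendsto_integral (hline R (abs_of_pos hR)) hat hbt)).add
    (hvert b (fun n => (hb1 n).trans (le_abs_self _)) hb)).sub
    (hvert a (fun n => by
      have h1 := ha2 n
      have h2 := neg_le_abs (a n)
      linarith) ha)
  rw [add_zero, sub_zero] at hlim
  -- Summability is already known, so the limit along the finite windows `u n` identifies the sum.
  have hS := (hsum.mul_left (2 * Real.pi * I)).hasSum
  have h3 := hS.comp hut
  have h4 : (fun n => rectIntegral g (a n) (b n) R) =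
      (fun s : Finset Λ => ∑ x ∈ s, 2 * Real.pi * I * (massCoeff φ ψ x * f x)) ∘ u :=
    funext hrect
  rw [← h4] at h3
  rw [tendsto_nhds_unique hlim h3]
  exact hS

/-- The Poisson-type formula for test functions whose Fourier transform has compact support. -/
theorem hasSum_amplitude_of_hasCompactSupport {φ ψ : ℂ → ℂ} (hφ : Differentiable ℂ φ)
    (hψ : Differentiable ℂ ψ) (hreal : ∀ z ∈ zeroSet φ, z.im = 0)
    (hsimple : ∀ z ∈ zeroSet φ, deriv φ z ≠ 0) (hud : IsUniformlyDiscrete (realZeroSet φ))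
    (hbd : ∀ R ε : ℝ, 0 < ε → ∃ M : ℝ, 0 ≤ M ∧ ∀ z : ℂ, |z.im| ≤ R →
      (∀ w, φ w = 0 → ε ≤ dist z w) → ‖ψ z / φ z‖ ≤ M)
    {K : ℝ} (hK : ∀ x ∈ realZeroSet φ, ‖massCoeff φ ψ x‖ ≤ K)
    {Sp Sm : Set ℝ} {p q : ℝ → ℂ} (hSp : Sp.Countable) (hSm : Sm.Countable)
    (hp : HasUpperExpansion (fun z => ψ z / φ z) Sp p)
    (hq : HasLowerExpansion (fun z => ψ z / φ z) Sm q)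
    {h : ℝ → ℂ} (hh : ContDiff ℝ 2 h) (hc : HasCompactSupport h) :
    HasSum (fun s : ℝ => amplitude p q s * h s)
      (∑' x : realZeroSet φ, massCoeff φ ψ x * expTransform h x) := by
  obtain ⟨δ, hδ, hsep⟩ := id hud
  obtain ⟨hp0, R₁, hR₁, hp⟩ := hp
  obtain ⟨hq0, R₂, hR₂, hq⟩ := hq
  -- Both expansions must hold on the lines Im z = ±R of one contour.
  set R := max R₁ R₂
  have hR : 0 < R := lt_max_of_lt_left hR₁
  obtain ⟨M, hM0, hM⟩ := hbd R (min R (δ / 4)) (by positivity)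
  have hdecay : ∀ z : ℂ, |z.im| ≤ R → (1 + ‖z‖ ^ 2) * ‖expTransform h z‖ ≤
      expNorm R h + expNorm R (deriv (deriv h)) := fun z hz =>
    one_add_sq_mul_norm_expTransform_le hh hc hz
  have hC0 : 0 ≤ expNorm R h + expNorm R (deriv (deriv h)) :=
    add_nonneg (expNorm_nonneg _ _) (expNorm_nonneg _ _)
  have hsum : Summable (fun x : realZeroSet φ => massCoeff φ ψ x * expTransform h x) := by
    refine Summable.of_norm_bounded (hud.summable_inv_one_add_sq.mul_left
      (K * (expNorm R h + expNorm R (deriv (deriv h))))) fun x => ?_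
    have h1 := hdecay (x : ℝ) (by simpa using hR.le)
    rw [Complex.norm_real, Real.norm_eq_abs, sq_abs] at h1
    rw [norm_mul, mul_assoc]
    refine mul_le_mul (hK x x.2) ?_ (norm_nonneg _) ((norm_nonneg _).trans (hK x x.2))
    rw [← div_eq_mul_inv, le_div_iff₀ (by positivity), mul_comm]
    exact h1
  have hres := hasSum_residues_strip hφ hψ (differentiable_expTransform hh.continuous hc) hreal
    hsimple hδ hsep hR hM0 hC0 hM hdecay hsum
  have : Countable Sp := hSp.to_subtype
  have : Countable Sm := hSm.to_subtype
  have hup := hasSum_integral_expansion hh hc (fun s : Sp => p s) (fun s => (s : ℝ)) R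
    (F := fun z => ψ z / φ z) fun x => hp _ (by simp [R])
  have hlow := hasSum_integral_expansion hh hc (fun s : Sm => q s) (fun s => -(s : ℝ)) (-R)
    (F := fun z => ψ z / φ z) fun x => by
      have := hq (x + ((-R : ℝ) : ℂ) * Complex.I) (by simp [R])
      convert this using 3
      rw [wave]; push_cast; ring_nf
  simp only [neg_neg] at hlow
  -- The coefficients vanish off `Sp` and `Sm`, so both series extend over ℝ and, after s ↦ -s in
  -- the first, can be subtracted termwise.
  have hup' : HasSum (fun s : ℝ => p s * h (-s)) _ :=
    (hasSum_subtype_iff_of_support_subset (f := fun s : ℝ => p s * h (-s)) (s := Sp)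
      fun s hs => by
        by_contra hs'
        exact hs (by simp only [hp0 s hs', zero_mul])).1 hup
  have hlow' : HasSum (fun s : ℝ => q s * h s) _ :=
    (hasSum_subtype_iff_of_support_subset (f := fun s : ℝ => q s * h s) (s := Sm)
      fun s hs => by
        by_contra hs'
        exact hs (by simp only [hq0 s hs', zero_mul])).1 hlow
  have hup'' := (Equiv.neg ℝ).hasSum_iff.2 hup'
  have htot := (hlow'.sub hup'').mul_left (2 * Real.pi * Complex.I)⁻¹
  have hne : (2 * Real.pi * Complex.I : ℂ) ≠ 0 := Complex.two_pi_I_ne_zero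
  have e1 : (fun s : ℝ => amplitude p q s * h s) = fun s => (2 * Real.pi * Complex.I)⁻¹ *
      (q s * h s - ((fun s : ℝ => p s * h (-s)) ∘ Equiv.neg ℝ) s) := by
    ext s
    simp only [amplitude, Function.comp, Equiv.neg_apply, neg_neg]
    field_simp
  rw [e1, ← inv_mul_cancel_left₀ hne
    (∑' x : realZeroSet φ, massCoeff φ ψ x * expTransform h x), ← tsum_mul_left, hres.tsum_eq]
  exact htot

/-! ### From compactly supported to Schwartz functions -/

lemma exists_cutoff : ∃ χ : ℝ → ℂ, ContDiff ℝ 2 χ ∧ HasCompactSupport χ ∧ χ 0 = 1 ∧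
    ∀ t, 1 ≤ |t| → χ t = 0 := by
  set b : ContDiffBump (0 : ℝ) := ⟨1 / 2, 1, by norm_num, by norm_num⟩
  refine ⟨fun t => ((b t : ℝ) : ℂ), Complex.ofRealCLM.contDiff.comp b.contDiff,
    b.hasCompactSupport.comp_left (g := fun x : ℝ => (x : ℂ)) Complex.ofReal_zero, ?_,
    fun t ht => ?_⟩
  · simp [b.one_of_mem_closedBall (Metric.mem_closedBall_self (by norm_num [b]))]
  · simp only [Complex.ofReal_eq_zero]
    exact b.zero_of_le_dist (by simpa [b] using ht)

lemma expNorm_zero (h : ℝ → ℂ) : expNorm 0 h = ∫ t, ‖h t‖ := by simp [expNorm]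

/-- Narrowing a bump to width ε spreads its transform to scale 1/ε with a factor ε, exactly the
weight in `IsUniformlyDiscrete.exists_sum_le`. -/
lemma expTransform_dilate_translate (h : ℝ → ℂ) (s : ℝ) {ε : ℝ} (hε : 0 < ε) (x : ℝ) :
    expTransform (fun t => h ((t - s) / ε)) x = ε * wave s x * expTransform h ((ε * x : ℝ) : ℂ) := by
  have h1 : ∀ t : ℝ, h ((t - s) / ε) * wave t x =
      (fun u : ℝ => h (ε⁻¹ * u) * wave u x) (t - s) * wave s x := by
    intro t
    simp only
    rw [mul_assoc, ← wave_add_freq, sub_add_cancel, div_eq_inv_mul]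
  have h2 : ∀ u : ℝ, h (ε⁻¹ * u) * wave u x =
      (fun v : ℝ => h v * wave v ((ε * x : ℝ) : ℂ)) (ε⁻¹ * u) := by
    intro u
    have hε' : (ε : ℂ) ≠ 0 := by exact_mod_cast hε.ne'
    simp only [wave]
    congr 2
    push_cast
    field_simp
  rw [expTransform]
  simp only [h1]
  rw [MeasureTheory.integral_mul_const,
    MeasureTheory.integral_sub_right_eq_self (fun u : ℝ => h (ε⁻¹ * u) * wave u x) s]
  simp only [h2]
  rw [MeasureTheory.Measure.integral_comp_mul_left (fun v : ℝ => h v * wave v ((ε * x : ℝ) : ℂ)),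
    inv_inv, abs_of_pos hε, Complex.real_smul, expTransform]
  ring

lemma IsLocallyFiniteSet.countable {S : Set ℝ} (hS : IsLocallyFiniteSet S) : S.Countable := by
  refine (Set.countable_iUnion fun n : ℕ => (hS n).countable).mono fun x hx => ?_
  obtain ⟨n, hn⟩ := exists_nat_gt |x|
  exact Set.mem_iUnion.2 ⟨n, hx, abs_lt.1 hn⟩

lemma IsLocallyFiniteSet.exists_isolating_radius {S : Set ℝ} (hS : IsLocallyFiniteSet S) (s : ℝ) :
    ∃ ε : ℝ, 0 < ε ∧ ε ≤ 1 ∧ ∀ t ∈ S, t ≠ s → ε ≤ |t - s| := by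
  have hfin : ((S ∩ Set.Ioo (-(|s| + 1)) (|s| + 1)) \ {s}).Finite := (hS _).subset Set.sdiff_subset
  obtain ⟨ε, hε, h⟩ := Metric.isOpen_iff.1 hfin.isClosed.isOpen_compl s (by simp)
  refine ⟨min ε 1, by positivity, min_le_right _ _, fun t ht hts => ?_⟩
  by_contra! hlt
  have h1 : t ∈ Metric.ball s ε := by
    rw [Metric.mem_ball, Real.dist_eq]; exact hlt.trans_le (min_le_left _ _)
  refine h h1 ⟨⟨ht, abs_lt.1 ?_⟩, hts⟩
  have h2 := hlt.trans_le (min_le_right _ _)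
  have h3 := abs_sub_abs_le_abs_sub t s
  linarith

lemma exists_schwartz_bound (N : ℕ) : ∃ (I : Finset (ℕ × ℕ)) (C : ℝ), 0 ≤ C ∧
    ∀ (f : 𝓢(ℝ, ℂ)) (x : ℝ),
      ‖f x‖ ≤ C * I.sup (schwartzSeminormFamily ℂ ℝ ℂ) f * ((1 + |x|) ^ N)⁻¹ := by
  refine ⟨Finset.Iic (N, 0), 2 ^ N, by positivity, fun f x => ?_⟩
  have h := SchwartzMap.one_add_le_sup_seminorm_apply (𝕜 := ℂ) (m := (N, 0)) (k := N) (n := 0)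
    le_rfl le_rfl f x
  rw [norm_iteratedFDeriv_zero, Real.norm_eq_abs] at h
  rw [← div_eq_mul_inv, le_div_iff₀ (by positivity), mul_comm]
  exact h

section

variable {Λ : Set ℝ} {c : ℝ → ℂ} {K : ℝ}

lemma summable_mul_of_decay (hΛ : IsUniformlyDiscrete Λ) (hK : ∀ x ∈ Λ, ‖c x‖ ≤ K) {f : ℝ → ℂ}
    {C : ℝ} (hC : ∀ x, (1 + x ^ 2) * ‖f x‖ ≤ C) : Summable (fun x : Λ => c x * f x) := by
  refine Summable.of_norm_bounded (hΛ.summable_inv_one_add_sq.mul_left (K * C)) fun x => ?_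
  rw [norm_mul, mul_assoc]
  refine mul_le_mul (hK x x.2) ?_ (norm_nonneg _) ((norm_nonneg _).trans (hK x x.2))
  rw [← div_eq_mul_inv, le_div_iff₀ (by positivity), mul_comm]
  exact hC x

/-- A measure with bounded masses on a uniformly discrete set is a tempered distribution. -/
theorem exists_temperedDistribution_hasSum (hΛ : IsUniformlyDiscrete Λ)
    (hK : ∀ x ∈ Λ, ‖c x‖ ≤ K) :
    ∃ μ : 𝓢'(ℝ, ℂ), ∀ f : 𝓢(ℝ, ℂ), HasSum (fun x : Λ => c x * f x) (μ f) := by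
  obtain ⟨I, C, hC, hb⟩ := exists_schwartz_bound 2
  have hdec : ∀ (f : 𝓢(ℝ, ℂ)) (x : ℝ),
      (1 + x ^ 2) * ‖f x‖ ≤ C * I.sup (schwartzSeminormFamily ℂ ℝ ℂ) f := by
    intro f x
    have h1 := hb f x
    rw [← div_eq_mul_inv, le_div_iff₀ (by positivity)] at h1
    have h2 : 1 + x ^ 2 ≤ (1 + |x|) ^ 2 := by nlinarith [abs_nonneg x, sq_abs x]
    nlinarith [mul_le_mul_of_nonneg_right h2 (norm_nonneg (f x))]
  have hs : ∀ f : 𝓢(ℝ, ℂ), Summable (fun x : Λ => c x * f x) := fun f =>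
    summable_mul_of_decay hΛ hK (hdec f)
  set W : ℝ := ∑' x : Λ, (1 + (x : ℝ) ^ 2)⁻¹
  have hW : 0 ≤ W := tsum_nonneg fun x => by positivity
  let T : 𝓢(ℝ, ℂ) →L[ℂ] ℂ := SchwartzMap.mkCLMtoNormedSpace (fun f => ∑' x : Λ, c x * f x)
    (fun f g => by
      simp only [add_apply, mul_add]
      exact (hs f).tsum_add (hs g))
    (fun a f => by
      simp only [smul_apply, smul_eq_mul, RingHom.id_apply, mul_left_comm _ a]
      exact tsum_mul_left)
    ⟨I, |K| * C * W, by positivity, fun f => by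
      have h1 := tsum_of_norm_bounded (f := fun x : Λ => c x * f x)
        ((hΛ.summable_inv_one_add_sq.hasSum).mul_left
          (|K| * (C * I.sup (schwartzSeminormFamily ℂ ℝ ℂ) f))) fun x => by
          rw [norm_mul, mul_assoc]
          refine mul_le_mul ((hK x x.2).trans (le_abs_self K)) ?_ (norm_nonneg _) (abs_nonneg _)
          rw [← div_eq_mul_inv, le_div_iff₀ (by positivity), mul_comm]
          exact hdec f x
      refine h1.trans (le_of_eq ?_)
      ring⟩
  exact ⟨ContinuousLinearMap.toPointwiseConvergenceCLM _ _ _ _ T, fun f => (hs f).hasSum⟩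

end

/-- If a Poisson-type formula holds for compactly supported test functions, then its amplitudes
are bounded. -/
theorem exists_bound_amplitudes {Λ S : Set ℝ} {c a : ℝ → ℂ} {K : ℝ} (hΛ : IsUniformlyDiscrete Λ)
    (hK : ∀ x ∈ Λ, ‖c x‖ ≤ K) (hS : IsLocallyFiniteSet S) (ha : ∀ s, s ∉ S → a s = 0)
    (H : ∀ h : ℝ → ℂ, ContDiff ℝ 2 h → HasCompactSupport h →
      HasSum (fun s : ℝ => a s * h s) (∑' x : Λ, c x * expTransform h x)) :
    ∃ C : ℝ, ∀ s, ‖a s‖ ≤ C := by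
  obtain ⟨χ, hχ, hχc, hχ0, hχs⟩ := exists_cutoff
  obtain ⟨W, hW0, hW⟩ := hΛ.exists_sum_le
  set D : ℝ := expNorm 0 χ + expNorm 0 (deriv (deriv χ))
  have hD0 : 0 ≤ D := add_nonneg (expNorm_nonneg _ _) (expNorm_nonneg _ _)
  refine ⟨|K| * D * W, fun s => ?_⟩
  obtain ⟨ε, hε, hε1, hiso⟩ := hS.exists_isolating_radius s
  -- A bump that isolates s from the rest of S: the spectral side of `H` collapses to a s.
  set h : ℝ → ℂ := fun t => χ ((t - s) / ε) with hh
  have hcd : ContDiff ℝ 2 h := hχ.comp (by fun_prop)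
  have hcs : HasCompactSupport h := by
    refine HasCompactSupport.intro (isCompact_closedBall s ε) fun t ht => hχs _ ?_
    rw [Metric.mem_closedBall, Real.dist_eq, not_le] at ht
    rw [abs_div, abs_of_pos hε, one_le_div hε]
    exact ht.le
  have h1 := H h hcd hcs
  have h2 : HasSum (fun t : ℝ => a t * h t) (a s * h s) := by
    refine hasSum_single s fun t hts => ?_
    by_cases ht : t ∈ S
    · have : h t = 0 := hχs _ (by
        rw [abs_div, abs_of_pos hε, one_le_div hε]
        exact hiso t ht hts)
      rw [this, mul_zero]
    · rw [ha t ht, zero_mul]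
  have h3 : h s = 1 := by simp [hh, hχ0]
  rw [h3, mul_one] at h2
  rw [h2.unique h1]
  have hsum : Summable (fun x : Λ => ε * (1 + (ε * (x : ℝ)) ^ 2)⁻¹) :=
    summable_of_sum_le (fun x => by dsimp; positivity) (hW ε hε hε1)
  refine (tsum_of_norm_bounded (hsum.hasSum.mul_left (|K| * D)) fun x => ?_).trans
    (mul_le_mul_of_nonneg_left (hsum.tsum_le_of_sum_le (hW ε hε hε1)) (by positivity))
  have h4 := one_add_sq_mul_norm_expTransform_le hχ hχc (R := 0)
    (z := ((ε * (x : ℝ) : ℝ) : ℂ)) (by simp)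
  rw [Complex.norm_real, Real.norm_eq_abs, sq_abs] at h4
  rw [expTransform_dilate_translate χ s hε, norm_mul, norm_mul, norm_mul, norm_wave_ofReal,
    Complex.norm_real, Real.norm_eq_abs, abs_of_pos hε, mul_one, mul_assoc]
  refine mul_le_mul ((hK x x.2).trans (le_abs_self K)) ?_ (by positivity) (abs_nonneg _)
  rw [mul_left_comm]
  refine mul_le_mul_of_nonneg_left ?_ hε.le
  rw [← div_eq_mul_inv, le_div_iff₀ (by positivity), mul_comm]
  exact h4

/-- The truncations of a Schwartz function have uniformly decaying Fourier transforms. -/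
theorem exists_uniform_bound_truncation {χ : ℝ → ℂ} (hχ : ContDiff ℝ 2 χ)
    (hχc : HasCompactSupport χ) (h : 𝓢(ℝ, ℂ)) :
    ∃ C : ℝ, ∀ ε : ℝ, 0 < ε → ε ≤ 1 → ∀ x : ℝ,
      (1 + x ^ 2) * ‖expTransform (fun t => χ (ε * t) * h t) x‖ ≤ C := by
  have hχ1 : ContDiff ℝ 1 (deriv χ) := hχ.deriv'
  obtain ⟨B₀, hB₀⟩ := hχc.exists_bound_of_continuous hχ.continuous
  obtain ⟨B₁, hB₁⟩ := hχc.deriv.exists_bound_of_continuous hχ1.continuous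
  obtain ⟨B₂, hB₂⟩ := hχc.deriv.deriv.exists_bound_of_continuous (hχ1.continuous_deriv le_rfl)
  set h' : 𝓢(ℝ, ℂ) := SchwartzMap.derivCLM ℂ ℂ h
  set h'' : 𝓢(ℝ, ℂ) := SchwartzMap.derivCLM ℂ ℂ h'
  have hd : ∀ t, HasDerivAt h (h' t) t := fun t => (h.differentiable t).hasDerivAt
  have hd' : ∀ t, HasDerivAt h' (h'' t) t := fun t => (h'.differentiable t).hasDerivAt
  -- Majorants for the L¹ norms of χ(ε·)h and its second derivative; each derivative falling on
  -- χ(ε·) brings a factor ε ≤ 1.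
  refine ⟨(∫ t, B₀ * ‖h t‖) + ∫ t, (B₂ * ‖h t‖ + 2 * B₁ * ‖h' t‖ + B₀ * ‖h'' t‖),
    fun ε hε hε1 x => ?_⟩
  set k : ℝ → ℂ := fun t => χ (ε * t) * h t
  have hscale : ∀ t : ℝ, HasDerivAt (fun t : ℝ => ε * t) ε t := fun t => by
    simpa using (hasDerivAt_id t).const_mul ε
  have hc0 : ∀ t, HasDerivAt (fun t : ℝ => χ (ε * t)) (ε * deriv χ (ε * t)) t := by
    intro t
    have := ((hχ.differentiable two_ne_zero (ε * t)).hasDerivAt).scomp t (hscale t)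
    exact this.congr_deriv (Complex.real_smul)
  have hc1 : ∀ t, HasDerivAt (fun t : ℝ => deriv χ (ε * t)) (ε * deriv (deriv χ) (ε * t)) t := by
    intro t
    have := ((hχ1.differentiable one_ne_zero (ε * t)).hasDerivAt).scomp t (hscale t)
    exact this.congr_deriv (Complex.real_smul)
  have hk1 : deriv k = fun t => ε * deriv χ (ε * t) * h t + χ (ε * t) * h' t :=
    funext fun t => ((hc0 t).mul (hd t)).deriv
  have hk2 : ∀ t, deriv (deriv k) t = (ε * (ε * deriv (deriv χ) (ε * t)) * h t +
      ε * deriv χ (ε * t) * h' t) + (ε * deriv χ (ε * t) * h' t + χ (ε * t) * h'' t) := by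
    intro t
    rw [hk1]
    exact ((((hc1 t).const_mul (ε : ℂ)).mul (hd t)).add ((hc0 t).mul (hd' t))).deriv
  have hkcd : ContDiff ℝ 2 k := (hχ.comp (by fun_prop)).mul (h.smooth 2)
  have hkcs : HasCompactSupport k := by
    have : HasCompactSupport (fun t : ℝ => χ (ε * t)) :=
      hχc.comp_homeomorph (Homeomorph.mulLeft₀ ε hε.ne')
    exact this.mul_right
  have hmain := one_add_sq_mul_norm_expTransform_le hkcd hkcs (R := 0) (z := (x : ℂ)) (by simp)
  rw [Complex.norm_real, Real.norm_eq_abs, sq_abs, expNorm_zero, expNorm_zero] at hmain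
  refine hmain.trans (add_le_add ?_ ?_)
  · refine MeasureTheory.integral_mono_of_nonneg
      (Filter.Eventually.of_forall fun t => norm_nonneg _) (h.integrable.norm.const_mul B₀)
      (Filter.Eventually.of_forall fun t => ?_)
    simp only [k, norm_mul]
    exact mul_le_mul_of_nonneg_right (hB₀ _) (norm_nonneg _)
  · refine MeasureTheory.integral_mono_of_nonneg
      (Filter.Eventually.of_forall fun t => norm_nonneg _)
      (((h.integrable.norm.const_mul B₂).add (h'.integrable.norm.const_mul (2 * B₁))).add
        (h''.integrable.norm.const_mul B₀))
      (Filter.Eventually.of_forall fun t => ?_)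
    dsimp only
    rw [hk2]
    have n0 := mul_le_mul_of_nonneg_right (hB₀ (ε * t)) (norm_nonneg (h'' t))
    have hεn : ‖(ε : ℂ)‖ ≤ 1 := by
      rw [Complex.norm_real, Real.norm_eq_abs, abs_of_pos hε]; exact hε1
    have n1 : ‖ε * deriv χ (ε * t) * h' t‖ ≤ B₁ * ‖h' t‖ := by
      rw [norm_mul, norm_mul]
      refine mul_le_mul_of_nonneg_right ?_ (norm_nonneg _)
      calc ‖(ε : ℂ)‖ * ‖deriv χ (ε * t)‖ ≤ 1 * ‖deriv χ (ε * t)‖ := by gcongr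
        _ ≤ B₁ := by rw [one_mul]; exact hB₁ _
    have n2 : ‖ε * (ε * deriv (deriv χ) (ε * t)) * h t‖ ≤ B₂ * ‖h t‖ := by
      rw [norm_mul, norm_mul, norm_mul]
      refine mul_le_mul_of_nonneg_right ?_ (norm_nonneg _)
      calc ‖(ε : ℂ)‖ * (‖(ε : ℂ)‖ * ‖deriv (deriv χ) (ε * t)‖)
          ≤ 1 * (1 * ‖deriv (deriv χ) (ε * t)‖) := by gcongr
        _ ≤ B₂ := by rw [one_mul, one_mul]; exact hB₂ _
    refine (norm_add_le _ _).trans ((add_le_add (norm_add_le _ _) (norm_add_le _ _)).trans ?_)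
    rw [norm_mul (χ (ε * t))]
    linarith

lemma tendsto_expTransform_truncation {χ : ℝ → ℂ} (hχ : Continuous χ)
    (hχc : HasCompactSupport χ) (hχ0 : χ 0 = 1) (h : 𝓢(ℝ, ℂ)) {ε : ℕ → ℝ}
    (hε : Filter.Tendsto ε Filter.atTop (nhds 0)) (x : ℝ) :
    Filter.Tendsto (fun n => expTransform (fun t => χ (ε n * t) * h t) x) Filter.atTop
      (nhds (expTransform h x)) := by
  obtain ⟨B, hB⟩ := hχc.exists_bound_of_continuous hχ
  refine MeasureTheory.tendsto_integral_of_dominated_convergence (fun t => B * ‖h t‖)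
    (fun n => ?_) (h.integrable.norm.const_mul B) (fun n => ?_) ?_
  · have := h.continuous
    exact Continuous.aestronglyMeasurable (by fun_prop)
  · refine Filter.Eventually.of_forall fun t => ?_
    rw [norm_mul, norm_mul, norm_wave_ofReal, mul_one]
    exact mul_le_mul_of_nonneg_right (hB _) (norm_nonneg _)
  · refine Filter.Eventually.of_forall fun t => ?_
    have h1 : Filter.Tendsto (fun n => χ (ε n * t)) Filter.atTop (nhds (χ (0 * t))) :=
      (hχ.tendsto _).comp (hε.mul_const t)
    rw [zero_mul, hχ0] at h1
    simpa using (h1.mul_const (h t)).mul_const (wave t x)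

/-- A Poisson-type formula for compactly supported test functions extends to all Schwartz
functions. -/
theorem hasSum_of_hasSum_hasCompactSupport {Λ S : Set ℝ} {c a : ℝ → ℂ} {K C : ℝ}
    (hΛ : IsUniformlyDiscrete Λ) (hK : ∀ x ∈ Λ, ‖c x‖ ≤ K) (hS : HasPolynomialCount S)
    (ha : ∀ s, s ∉ S → a s = 0) (hC : ∀ s, ‖a s‖ ≤ C)
    (H : ∀ h : ℝ → ℂ, ContDiff ℝ 2 h → HasCompactSupport h →
      HasSum (fun s : ℝ => a s * h s) (∑' x : Λ, c x * expTransform h x)) (f : 𝓢(ℝ, ℂ)) :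
    HasSum (fun s : ℝ => a s * 𝓕 f s) (∑' x : Λ, c x * f x) := by
  obtain ⟨χ, hχ, hχc, hχ0, -⟩ := exists_cutoff
  obtain ⟨B, hB⟩ := hχc.exists_bound_of_continuous hχ.continuous
  have hB0 : 0 ≤ B := (norm_nonneg _).trans (hB 0)
  have hC0 : 0 ≤ C := (norm_nonneg _).trans (hC 0)
  set h : 𝓢(ℝ, ℂ) := 𝓕 f
  obtain ⟨N, hN⟩ := hS.exists_summable
  obtain ⟨I, D, hD, hdec⟩ := exists_schwartz_bound N
  -- Bounded amplitudes, polynomial count and Schwartz decay together give absolute convergence.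
  have hsum : Summable (fun s : ℝ => ‖a s * h s‖) := by
    have h1 : Summable (fun s : S => ‖a s * h s‖) := by
      refine Summable.of_nonneg_of_le (fun s => norm_nonneg _) (fun s => ?_)
        (hN.mul_left (C * (D * I.sup (schwartzSeminormFamily ℂ ℝ ℂ) h)))
      rw [norm_mul, mul_assoc]
      exact mul_le_mul (hC s) (hdec h s) (norm_nonneg _) hC0
    have h2 : Function.support (fun s : ℝ => ‖a s * h s‖) ⊆ S := by
      intro s hs
      by_contra hs'
      exact hs (by simp only [ha s hs', zero_mul, norm_zero])
    exact ((hasSum_subtype_iff_of_support_subset h2).1 h1.hasSum).summable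
  set ε : ℕ → ℝ := fun n => 1 / ((n : ℝ) + 1)
  have hε : Filter.Tendsto ε Filter.atTop (nhds 0) := tendsto_one_div_add_atTop_nhds_zero_nat
  have hεpos : ∀ n, 0 < ε n := fun n => by positivity
  have hε1 : ∀ n, ε n ≤ 1 := fun n => by
    rw [div_le_one (by positivity)]; linarith [(Nat.cast_nonneg n : (0 : ℝ) ≤ n)]
  have hleft : Filter.Tendsto (fun n => ∑' s : ℝ, a s * (χ (ε n * s) * h s)) Filter.atTop
      (nhds (∑' s : ℝ, a s * h s)) := by
    refine tendsto_tsum_of_dominated_convergence (hsum.mul_left B) (fun s => ?_)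
      (Filter.Eventually.of_forall fun n s => ?_)
    · have h1 : Filter.Tendsto (fun n => χ (ε n * s)) Filter.atTop (nhds (χ (0 * s))) :=
        (hχ.continuous.tendsto _).comp (hε.mul_const s)
      rw [zero_mul, hχ0] at h1
      simpa using (h1.mul_const (h s)).const_mul (a s)
    · rw [mul_left_comm, norm_mul]
      exact mul_le_mul_of_nonneg_right (hB _) (norm_nonneg _)
  obtain ⟨M, hM⟩ := exists_uniform_bound_truncation hχ hχc h
  have hright : Filter.Tendsto (fun n => ∑' x : Λ, c x *
      expTransform (fun t => χ (ε n * t) * h t) x) Filter.atTop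
      (nhds (∑' x : Λ, c x * expTransform h x)) := by
    refine tendsto_tsum_of_dominated_convergence
      (hΛ.summable_inv_one_add_sq.mul_left (K * M)) (fun x => ?_)
      (Filter.Eventually.of_forall fun n x => ?_)
    · exact (tendsto_expTransform_truncation hχ.continuous hχc hχ0 h hε x).const_mul _
    · rw [norm_mul, mul_assoc]
      refine mul_le_mul (hK x x.2) ?_ (norm_nonneg _) ((norm_nonneg _).trans (hK x x.2))
      rw [← div_eq_mul_inv, le_div_iff₀ (by positivity), mul_comm]
      exact hM (ε n) (hεpos n) (hε1 n) x
  have heq : ∀ n, ∑' s : ℝ, a s * (χ (ε n * s) * h s) =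
      ∑' x : Λ, c x * expTransform (fun t => χ (ε n * t) * h t) x := by
    intro n
    refine (H _ ?_ ?_).tsum_eq
    · exact (hχ.comp (by fun_prop)).mul (h.smooth 2)
    · have : HasCompactSupport (fun t : ℝ => χ (ε n * t)) :=
        hχc.comp_homeomorph (Homeomorph.mulLeft₀ (ε n) (hεpos n).ne')
      exact this.mul_right
  simp only [heq] at hleft
  have hfin := tendsto_nhds_unique hleft hright
  have hinv : ∀ x : ℝ, expTransform h x = f x := by
    intro x
    rw [expTransform_ofReal, ← SchwartzMap.fourierInv_coe, FourierTransform.fourierInv_fourier_eq]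
  simp only [hinv] at hfin
  rw [← hfin]
  exact hsum.of_norm.hasSum

/-! ### The crystalline measure of a quotient of exponential polynomials -/

lemma IsUniformlyDiscrete.realZeroSet {φ : ℂ → ℂ} (h : IsUniformlyDiscrete (zeroSet φ)) :
    IsUniformlyDiscrete (realZeroSet φ) := by
  obtain ⟨δ, hδ, hsep⟩ := h
  refine ⟨δ, hδ, fun x hx y hy hxy => ?_⟩
  have := hsep x hx y hy (by exact_mod_cast hxy)
  rwa [Complex.dist_eq, ← Complex.ofReal_sub, Complex.norm_real, ← dist_eq_norm] at this

lemma IsExpPolyR.exists_expSum {φ : ℂ → ℂ} (hφ : IsExpPolyR φ) :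
    ∃ (A : Finset ℝ) (d : ℝ → ℂ), A.Nonempty ∧ (∀ a ∈ A, d a ≠ 0) ∧ φ = expSum A d := by
  obtain ⟨A, d, hd, rfl⟩ := hφ.isExpPoly.exists_expSum
  refine ⟨A, d, Finset.nonempty_iff_ne_empty.2 ?_, hd, rfl⟩
  rintro rfl
  have h0 : expSum ∅ d = fun _ => 0 := by ext z; simp [expSum]
  -- The zero function would vanish at 0 together with its derivative, so simplicity of the zeros
  -- excludes it.
  exact hφ.simple 0 (by simp [zeroSet, h0]) (by rw [h0]; simp)

/-- The circle of radius δ/2 about a zero stays δ/2 away from all zeros, so ψ/φ is uniformly bounded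
on it. -/
lemma exists_bound_massCoeff {A : Finset ℝ} (hA : A.Nonempty) {d : ℝ → ℂ}
    (hd : ∀ a ∈ A, d a ≠ 0) (hφ : IsExpPolyR (expSum A d)) (B : Finset ℝ) (e : ℝ → ℂ) :
    ∃ K : ℝ, ∀ x ∈ realZeroSet (expSum A d), ‖massCoeff (expSum A d) (expSum B e) x‖ ≤ K := by
  obtain ⟨δ, hδ, hsep⟩ := hφ.uniformlyDiscrete
  obtain ⟨M, -, hM⟩ := exists_bound_div_away_from_zeros hA hd B e (δ / 2) (half_pos hδ)
  refine ⟨M * (δ / 2), fun x hx => norm_div_deriv_le (differentiable_expSum A d)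
    (differentiable_expSum B e) hx (hφ.simple _ hx) (half_pos hδ) (fun z hz hne h0 => ?_)
    fun z hz => hM z ?_ fun w hw => ?_⟩
  · have := hsep z h0 x hx hne
    linarith
  · rw [← hz, dist_eq_norm]
    simpa using Complex.abs_im_le_norm (z - x)
  · rcases eq_or_ne w (x : ℂ) with rfl | hne
    · exact hz.ge
    · have h1 := hsep w hw x hx hne
      have h2 := dist_triangle_left w x z
      linarith

lemma amplitude_eq_zero {F : ℂ → ℂ} {Sp Sm : Set ℝ} {p q : ℝ → ℂ} (hp : HasUpperExpansion F Sp p)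
    (hq : HasLowerExpansion F Sm q) {s : ℝ} (hs : s ∉ spectrumSet Sp Sm) :
    amplitude p q s = 0 := by
  have h1 : s ∉ Sm := fun h => hs (Or.inl h)
  have h2 : -s ∉ Sp := fun h => hs (Or.inr h)
  rw [amplitude, hq.1 s h1, hp.1 _ h2, sub_zero, zero_div]

lemma HasSum.subtype_of_zero_off {a g : ℝ → ℂ} {S : Set ℝ} {v : ℂ} (ha : ∀ s, s ∉ S → a s = 0)
    (h : HasSum (fun s : ℝ => a s * g s) v) : HasSum (fun s : S => a s * g s) v :=
  (hasSum_subtype_iff_of_support_subset (f := fun s : ℝ => a s * g s) fun s hs => by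
    by_contra hs'
    exact hs (by simp only [ha s hs', zero_mul])).2 h

lemma fourier_fourier_apply (f : 𝓢(ℝ, ℂ)) (s : ℝ) : 𝓕 (𝓕 f) s = f (-s) := by
  have h1 : 𝓕 (𝓕 f) s = 𝓕⁻ (𝓕 f) (-s) := by
    rw [SchwartzMap.fourierInv_coe, SchwartzMap.fourier_coe (𝓕 f), Real.fourierInv_eq_fourier_neg,
      neg_neg]
  rw [h1, FourierTransform.fourierInv_fourier_eq]

theorem corollary1 (φ ψ : ℂ → ℂ) (hφ : IsExpPolyR φ) (hψ : IsExpPoly ψ)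
    (hsub : ¬ zeroSet φ ⊆ zeroSet ψ) :
    ∃ μ : 𝓢'(ℝ, ℂ),
      -- `μ = ∑_{λ ∈ Λ_φ} c_λ δ_λ`, as a measure and on every Schwartz function
      IsAtomicMeasure μ (realZeroSet φ) (massCoeff φ ψ) ∧
      (∀ f : 𝓢(ℝ, ℂ), HasSum (fun x : realZeroSet φ => massCoeff φ ψ x * f x) (μ f)) ∧
      (∃ C : ℝ, ∀ x ∈ realZeroSet φ, ‖massCoeff φ ψ x‖ ≤ C) ∧
      IsCrystallineMeasure μ ∧
      -- the explicit spectrum and amplitudes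
      ∃ (Sp Sm : Set ℝ) (p q : ℝ → ℂ),
        HasUpperExpansion (fun z => ψ z / φ z) Sp p ∧
        HasLowerExpansion (fun z => ψ z / φ z) Sm q ∧
        HasPolynomialCount Sp ∧
        HasPolynomialCount Sm ∧
        HasPolynomialCount (spectrumSet Sp Sm) ∧
        (∃ C : ℝ, ∀ s ∈ spectrumSet Sp Sm, ‖amplitude p q s‖ ≤ C) ∧
        -- the Poisson-type formula `∑ c_λ f(λ) = ∑ a_s (𝓕 f)(s)`
        (∀ f : 𝓢(ℝ, ℂ),
          HasSum (fun s : spectrumSet Sp Sm => amplitude p q s * 𝓕 f s) (μ f)) ∧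
        -- equivalently, `𝓕 μ = ∑ a_s δ_{-s}`, as a measure and on every Schwartz function
        IsAtomicMeasure (𝓕 μ) (-spectrumSet Sp Sm) (fun t => amplitude p q (-t)) ∧
        (∀ f : 𝓢(ℝ, ℂ),
          HasSum (fun s : spectrumSet Sp Sm => amplitude p q s * f (-s)) ((𝓕 μ) f)) := by
  obtain ⟨A, d, hA, hd, rfl⟩ := hφ.exists_expSum
  obtain ⟨B, e, -, rfl⟩ := hψ.exists_expSum
  have hud := hφ.uniformlyDiscrete.realZeroSet
  obtain ⟨K, hK⟩ := exists_bound_massCoeff hA hd hφ B e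
  obtain ⟨Sp, p, hp, hSp⟩ := exists_hasUpperExpansion hA hd B e
  obtain ⟨Sm, q, hq, hSm⟩ := exists_hasLowerExpansion hA hd B e
  obtain ⟨μ, hμ⟩ := exists_temperedDistribution_hasSum hud hK
  have hS : HasPolynomialCount (spectrumSet Sp Sm) := hSm.union hSp.neg
  have ha : ∀ s, s ∉ spectrumSet Sp Sm → amplitude p q s = 0 := fun s hs =>
    amplitude_eq_zero hp hq hs
  have H : ∀ h : ℝ → ℂ, ContDiff ℝ 2 h → HasCompactSupport h →
      HasSum (fun s : ℝ => amplitude p q s * h s) (∑' x : realZeroSet (expSum A d),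
        massCoeff (expSum A d) (expSum B e) x * expTransform h x) := fun h hh hc =>
    hasSum_amplitude_of_hasCompactSupport (differentiable_expSum A d) (differentiable_expSum B e)
      hφ.real hφ.simple hud (fun R ε hε => exists_bound_div_away_from_zeros hA hd B e R hε) hK
      hSp.1.countable hSm.1.countable hp hq hh hc
  obtain ⟨C, hC⟩ := exists_bound_amplitudes hud hK hS.1 ha H
  have hpoisson : ∀ f : 𝓢(ℝ, ℂ), HasSum (fun s : ℝ => amplitude p q s * 𝓕 f s) (μ f) :=
    fun f => by
      rw [← (hμ f).tsum_eq]
      exact hasSum_of_hasSum_hasCompactSupport hud hK hS ha hC H f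
  have hfourier : ∀ f : 𝓢(ℝ, ℂ), HasSum (fun s : ℝ => amplitude p q s * f (-s)) ((𝓕 μ) f) :=
    fun f => by
      -- `(𝓕 μ) f` is by definition `μ (𝓕 f)`, and applying 𝓕 twice reflects the argument.
      have := hpoisson (𝓕 f)
      simp only [fourier_fourier_apply] at this
      exact this
  have hatom : IsAtomicMeasure μ (realZeroSet (expSum A d))
      (massCoeff (expSum A d) (expSum B e)) := ⟨hud.isLocallyFiniteSet, fun f _ => hμ f⟩
  have hatom' : IsAtomicMeasure (𝓕 μ) (-spectrumSet Sp Sm) (fun t => amplitude p q (-t)) := by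
    refine ⟨hS.neg.1, fun f _ => ?_⟩
    have h1 : HasSum (fun t : ℝ => amplitude p q (-t) * f (- -t)) ((𝓕 μ) f) :=
      (Equiv.neg ℝ).hasSum_iff.2 (hfourier f)
    simp only [neg_neg] at h1
    exact HasSum.subtype_of_zero_off (a := fun t => amplitude p q (-t)) (g := f)
      (S := -spectrumSet Sp Sm) (fun s hs => ha (-s) hs) h1
  exact ⟨μ, hatom, hμ, ⟨K, hK⟩, ⟨⟨_, _, hatom⟩, _, _, hatom'⟩, Sp, Sm, p, q, hp, hq, hSp, hSm, hS,
    ⟨C, fun s _ => hC s⟩, fun f => (hpoisson f).subtype_of_zero_off ha, hatom',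
    fun f => HasSum.subtype_of_zero_off (g := fun s => f (-s)) ha (hfourier f)⟩
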